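/- Directions are unit vectors $v\in S^1\subset\mathbb R^2$. Two distinct points $a,b$ of a set $\Omega\subset S^1$ are called neighbors in $\Omega$ if one of the two open arcs of $S^1$ with endpoints $a,b$ contains no point of $\Omega$; such an empty open arc is called a gap of $\Omega$. A set $\Omega\subset S^1$ is $1$-lacunary if it is the set of terms of a finite or infinite sequence of directions $v_0,v_1,v_2,\dots$ for which there is a direction $v_\infty$ such that, for every $k$ for which $v_{k+1}$ is defined, $v_k$ and $v_{k+1}$ are neighbors in $\Omega$ and $$\tfrac12|v_k-v_{k+1}|<|v_{k+1}-v_\infty|<|v_k-v_{k+1}|.$$ For $N\ge 1$, a set $\Omega'$ is $(N+1)$-lacunary if there is an $N$-lacunary set $\Omega\subset\Omega'$ such that every point of $\Omega'\setminus\Omega$ lies in a gap of $\Omega$ and, for every gap $A$ of $\Omega$, the set $\Omega'\cap A$ is $1$-lacunary (possibly empty). For a set of directions $\Omega$ put $$M_\Omega f(x)=\sup_{x\in R\in\mathcal R_\Omega}\frac1{|R|}\int_R|f(y)|\,dy,$$ where $\mathcal R_\Omega$ is the set of all (closed, nondegenerate) rectangles in $\mathbb R^2$ with a side parallel to some direction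 of $\Omega$. Theorem 1. There is an absolute constant $C$ such that for every integer $N\ge1$, every $N$-lacunary set $\Omega$ and every $f\in L^2(\mathbb R^2)$, the function $M_\Omega f$ belongs to $L^2(\mathbb R^2)$ and $$\|M_\Omega f\|_{L^2(\mathbb R^2)}\le C\,N\,\|f\|_{L^2(\mathbb R^2)}.$$ -/

import Mathlib

open MeasureTheory
open scoped ENNReal NNReal

/-- The Euclidean plane. -/
abbrev Plane : Type := EuclideanSpace ℝ (Fin 2)

/-- The unit vector of angle `t`. -/
noncomputable def dirOfAngle (t : ℝ) : Plane := !₂[Real.cos t, Real.sin t]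

/-- The open arc of the unit circle that runs counterclockwise from `a` to `b`
(it is empty when `a = b`, or when `a` or `b` is not a unit vector). -/
def openArc (a b : Plane) : Set Plane :=
  {w | ∃ s r t : ℝ, s < r ∧ r < t ∧ t < s + 2 * Real.pi ∧
    a = dirOfAngle s ∧ w = dirOfAngle r ∧ b = dirOfAngle t}

/-- `b` is the first point of `Ω` after `a` in the counterclockwise order: `a` and `b` are distinct
points of `Ω`, and no point of `Ω` lies on the open arc from `a` to `b`. -/
def IsGap (Ω : Set Plane) (a b : Plane) : Prop :=
  a ∈ Ω ∧ b ∈ Ω ∧ a ≠ b ∧ Disjoint (openArc a b) Ω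

/-- `a` and `b` are neighboring points of the set of directions `Ω`. -/
def AreNeighbors (Ω : Set Plane) (a b : Plane) : Prop :=
  IsGap Ω a b ∨ IsGap Ω b a

/-- `Ω` is the set of terms of a `1`-lacunary sequence of directions `v 0, v 1, …`, finite (of
length `n`) or infinite (`n = ⊤`). -/
def IsOneLacunary (Ω : Set Plane) : Prop :=
  ∃ (n : ℕ∞) (v : ℕ → Plane) (vlim : Plane),
    Ω = {w | ∃ k : ℕ, (k : ℕ∞) < n ∧ w = v k} ∧
    (∀ k : ℕ, (k : ℕ∞) < n → ‖v k‖ = 1) ∧ ‖vlim‖ = 1 ∧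
    ∀ k : ℕ, ((k + 1 : ℕ) : ℕ∞) < n →
      AreNeighbors Ω (v k) (v (k + 1)) ∧
      (1 / 2) * ‖v k - v (k + 1)‖ < ‖v (k + 1) - vlim‖ ∧
      ‖v (k + 1) - vlim‖ < ‖v k - v (k + 1)‖

/-- `IsLacunary N Ω`: the set of directions `Ω` is `N`-lacunary, `N ≥ 1`.  An `(N + 1)`-lacunary
set `Ω'` arises from an `N`-lacunary set `Ω` by adding points between neighboring points of `Ω`, the
points that are added between any two neighbors forming a finite or infinite `1`-lacunary
sequence. -/
inductive IsLacunary : ℕ → Set Plane → Prop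
  | one (Ω : Set Plane) : IsOneLacunary Ω → IsLacunary 1 Ω
  | succ (N : ℕ) (Ω Ω' : Set Plane) : IsLacunary N Ω → Ω ⊆ Ω' →
      (∀ w ∈ Ω', w ∉ Ω → ∃ a b, IsGap Ω a b ∧ w ∈ openArc a b) →
      (∀ a b, IsGap Ω a b → IsOneLacunary (Ω' ∩ openArc a b)) →
      IsLacunary (N + 1) Ω'

/-- Rotation of a vector by a quarter turn. -/
noncomputable def rotQuarter (u : Plane) : Plane := !₂[-u 1, u 0]

/-- The closed rectangle with center `c` and sides of length `2 * p` parallel to the unit vector `u`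
and of length `2 * q` orthogonal to `u`. -/
def rectangle (u c : Plane) (p q : ℝ) : Set Plane :=
  {y | |inner ℝ (y - c) u| ≤ p ∧ |inner ℝ (y - c) (rotQuarter u)| ≤ q}

/-- All rectangles with a side parallel to some direction of `Ω`. -/
def rectanglesOf (Ω : Set Plane) : Set (Set Plane) :=
  {R | ∃ u ∈ Ω, ∃ (c : Plane) (p q : ℝ), 0 < p ∧ 0 < q ∧ R = rectangle u c p q}

/-- The directional maximal function: the supremum of the averages of `|f|` over the rectangles that
contain the point and have a side parallel to a direction of `Ω`. -/
noncomputable def directionalMaximal (Ω : Set Plane) (f : Plane → ℂ) (x : Plane) : ℝ≥0∞ :=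
  ⨆ (R : Set Plane) (_ : R ∈ rectanglesOf Ω) (_ : x ∈ R),
    (volume R)⁻¹ * ∫⁻ y in R, ‖f y‖ₑ

/-!
The proof works with the dual form of the maximal inequality.  A family of parallelograms `P i` and of
functions `g i ≥ 0` supported in them is given, and the sum `F` of the normalized indicators of
the `P i`, weighted by the masses of the `g i`, is to be bounded in `L²` by `B` times the sum of the
`g i` (`DualBound T B`, for slopes in `T`).  Applied to the pieces of the maximal function itself this
gives the maximal inequality (`DualBound.lintegral_sq_sup_le`).

For a single slope the estimate is a strong maximal theorem, which follows from the one-dimensional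
case; the latter is proved by `TT*` and an iteration over tripled intervals
(`lintegral_sq_intervalSum_le`).

The heart of the matter is an almost orthogonality principle (`DualBound.of_classes`): if the slopes
are divided into classes, and every slope `x` has reference slopes in a set `Z`, one of which is not
much farther from `x` than any given slope of another class, then the bound for all slopes is at most
the bound for the single classes, with the factor `1`, plus a multiple of the bound for `Z`.  Indeed,
in the expansion of the square of `F` a pair of parallelograms of different classes may be replaced,
up to a constant factor, by the pair in which the shorter one is turned into a reference direction
(`Para.volume_inter_div_le`).  The sum over these pairs is an inner product of `F` with a sum of the
same kind for `Z`, and a quadratic inequality for the norm of `F` results.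

The principle is used in two ways.  For a `1`-lacunary set, the classes are single points and the
reference direction is the limit `v∞`, except for at most two points of the set
(`IsOneLacunary.angularBound`).  For a set that arises by adding points in the gaps of a set `V`, the
classes are the parts in the gaps, and the reference directions are the end points of the gaps
(`AngularBound.of_arcs`).  Since the factor `1` is kept, each level of an `N`-lacunary set adds a
constant to the bound, when the levels are removed starting from the last one
(`IsLacunary.angularBound_of_gaps`).
-/

/-! ### Square functions and finite sums of indicators -/

theorem sq_lintegral_mul_le {α : Type*} [MeasurableSpace α] {μ : Measure α} {f g : α → ℝ≥0∞}
    (hf : AEMeasurable f μ) (hg : AEMeasurable g μ) :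
    (∫⁻ x, f x * g x ∂μ) ^ 2 ≤ (∫⁻ x, f x ^ 2 ∂μ) * ∫⁻ x, g x ^ 2 ∂μ := by
  have h := ENNReal.lintegral_mul_le_Lp_mul_Lq μ Real.HolderConjugate.two_two hf hg
  simp only [ENNReal.rpow_two, Pi.mul_apply] at h
  calc (∫⁻ x, f x * g x ∂μ) ^ 2
      ≤ ((∫⁻ x, f x ^ 2 ∂μ) ^ (1 / 2 : ℝ) * (∫⁻ x, g x ^ 2 ∂μ) ^ (1 / 2 : ℝ)) ^ 2 := by gcongr
    _ = _ := by
      rw [mul_pow, ← ENNReal.rpow_two, ← ENNReal.rpow_two, ← ENNReal.rpow_mul,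
        ← ENNReal.rpow_mul]
      norm_num

theorem ENNReal.sq_sum_le_card_mul {ι : Type*} (I : Finset ι) (f : ι → ℝ≥0∞) :
    (∑ i ∈ I, f i) ^ 2 ≤ I.card * ∑ i ∈ I, f i ^ 2 := by
  have h := ENNReal.rpow_sum_le_const_mul_sum_rpow I f (p := 2) (by norm_num)
  norm_num at h
  simpa using h

theorem ENNReal.sum_sq_le_sq_sum {ι : Type*} (I : Finset ι) (f : ι → ℝ≥0∞) :
    ∑ i ∈ I, f i ^ 2 ≤ (∑ i ∈ I, f i) ^ 2 := by
  rw [sq, Finset.sum_mul]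
  refine Finset.sum_le_sum fun i hi => ?_
  rw [sq]
  gcongr
  exact Finset.single_le_sum (f := f) (fun _ _ => zero_le) hi

theorem lintegral_sum_indicator_mul {α ι : Type*} [MeasurableSpace α] {μ : Measure α}
    (I : Finset ι) (b : ι → ℝ≥0∞) {S : ι → Set α} (hS : ∀ i, MeasurableSet (S i))
    {f : α → ℝ≥0∞} (hf : AEMeasurable f μ) :
    ∫⁻ x, (∑ i ∈ I, (S i).indicator (fun _ => b i) x) * f x ∂μ
      = ∑ i ∈ I, b i * ∫⁻ x in S i, f x ∂μ := by
  simp_rw [Finset.sum_mul]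
  rw [lintegral_finsetSum']
  · refine Finset.sum_congr rfl fun i _ => ?_
    rw [← lintegral_const_mul'' _ hf.restrict, ← lintegral_indicator (hS i)]
    refine lintegral_congr fun x => ?_
    by_cases hx : x ∈ S i <;> simp [hx]
  · intro i _
    exact ((measurable_const.indicator (hS i)).aemeasurable).mul hf

theorem lintegral_sq_sum_indicator {α ι : Type*} [MeasurableSpace α] {μ : Measure α}
    (I : Finset ι) (b : ι → ℝ≥0∞) {S : ι → Set α} (hS : ∀ i, MeasurableSet (S i)) :
    ∫⁻ x, (∑ i ∈ I, (S i).indicator (fun _ => b i) x) ^ 2 ∂μ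
      = ∑ i ∈ I, ∑ k ∈ I, b i * b k * μ (S i ∩ S k) := by
  have hm : Measurable fun x => ∑ i ∈ I, (S i).indicator (fun _ => b i) x :=
    Finset.measurable_fun_sum I fun i _ => measurable_const.indicator (hS i)
  simp_rw [sq]
  rw [lintegral_sum_indicator_mul I b hS hm.aemeasurable]
  refine Finset.sum_congr rfl fun i _ => ?_
  rw [lintegral_finsetSum _ fun k _ => measurable_const.indicator (hS k), Finset.mul_sum]
  refine Finset.sum_congr rfl fun k _ => ?_
  rw [lintegral_indicator (hS k), lintegral_const, Measure.restrict_apply MeasurableSet.univ,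
    Set.univ_inter, Measure.restrict_apply (hS k), Set.inter_comm, mul_assoc]

theorem lintegral_eq_setLIntegral_of_support {α : Type*} [MeasurableSpace α] {μ : Measure α}
    {g : α → ℝ≥0∞} {S : Set α} (hS : MeasurableSet S) (h : ∀ x ∉ S, g x = 0) :
    ∫⁻ x, g x ∂μ = ∫⁻ x in S, g x ∂μ := by
  rw [← lintegral_indicator hS]
  refine lintegral_congr fun x => ?_
  by_cases hx : x ∈ S
  · simp [hx]
  · simp [hx, h x hx]

theorem sq_lintegral_le_of_support {α : Type*} [MeasurableSpace α] {μ : Measure α}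
    {g : α → ℝ≥0∞} (hg : AEMeasurable g μ) {S : Set α} (hS : MeasurableSet S)
    (h : ∀ x ∉ S, g x = 0) :
    (∫⁻ x, g x ∂μ) ^ 2 ≤ (∫⁻ x, g x ^ 2 ∂μ) * μ S := by
  have h1 := sq_lintegral_mul_le hg ((measurable_const (a := (1 : ℝ≥0∞))).indicator hS).aemeasurable
    (μ := μ)
  have e1 : ∀ x, g x * S.indicator (fun _ => (1 : ℝ≥0∞)) x = g x := fun x => by
    by_cases hx : x ∈ S
    · simp [hx]
    · simp [hx, h x hx]
  have e2 : ∀ x, (S.indicator (fun _ => (1 : ℝ≥0∞)) x) ^ 2 = S.indicator (fun _ => (1 : ℝ≥0∞)) x :=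
    fun x => by by_cases hx : x ∈ S <;> simp [hx]
  simp_rw [e1, e2] at h1
  simpa [lintegral_indicator hS] using h1

/-! ### Averages over intervals -/

section Interval

variable {ι : Type*} (I : Finset ι) (c : ι → ℝ) (g : ι → ℝ → ℝ≥0∞)

/-- The sum of the normalized indicators of the intervals with centers `c i` and radii `R i`,
weighted by the masses of the functions `g i`. -/
noncomputable def intervalSum (R : ι → ℝ) (x : ℝ) : ℝ≥0∞ :=
  ∑ i ∈ I, (Metric.closedBall (c i) (R i)).indicator
    (fun _ => (∫⁻ y, g i y) / ENNReal.ofReal (2 * R i)) x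

theorem measurable_intervalSum (R : ι → ℝ) : Measurable (intervalSum I c g R) :=
  Finset.measurable_fun_sum I fun _ _ => measurable_const.indicator Metric.isClosed_closedBall.measurableSet

variable {I c g}

theorem lintegral_sq_intervalSum_le_card {R : ι → ℝ} (hR : ∀ i, 0 < R i)
    (hg : ∀ i ∈ I, Measurable (g i)) (hs : ∀ i ∈ I, ∀ x ∉ Metric.closedBall (c i) (R i), g i x = 0) :
    ∫⁻ x, intervalSum I c g R x ^ 2 ≤ I.card * ∫⁻ x, (∑ i ∈ I, g i x) ^ 2 := by
  have hB : ∀ i, MeasurableSet (Metric.closedBall (c i) (R i)) :=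
    fun i => Metric.isClosed_closedBall.measurableSet
  calc ∫⁻ x, intervalSum I c g R x ^ 2
      ≤ ∫⁻ x, I.card * ∑ i ∈ I, ((Metric.closedBall (c i) (R i)).indicator
          (fun _ => (∫⁻ y, g i y) / ENNReal.ofReal (2 * R i)) x) ^ 2 :=
        lintegral_mono fun x => ENNReal.sq_sum_le_card_mul I _
    _ = I.card * ∑ i ∈ I, ∫⁻ x, ((Metric.closedBall (c i) (R i)).indicator
          (fun _ => (∫⁻ y, g i y) / ENNReal.ofReal (2 * R i)) x) ^ 2 := by
        rw [lintegral_const_mul' _ _ (by simp), lintegral_finsetSum]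
        exact fun i _ => (measurable_const.indicator (hB i)).pow_const 2
    _ ≤ I.card * ∑ i ∈ I, ∫⁻ x, g i x ^ 2 := by
        refine mul_le_mul_right (Finset.sum_le_sum fun i hi => ?_) _
        have h0 : ENNReal.ofReal (2 * R i) ≠ 0 := by
          have := hR i; simp; linarith
        have e : ∀ x, ((Metric.closedBall (c i) (R i)).indicator
          (fun _ => (∫⁻ y, g i y) / ENNReal.ofReal (2 * R i)) x) ^ 2
          = (Metric.closedBall (c i) (R i)).indicator
          (fun _ => ((∫⁻ y, g i y) / ENNReal.ofReal (2 * R i)) ^ 2) x := fun x => by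
          by_cases hx : x ∈ Metric.closedBall (c i) (R i) <;> simp [hx]
        rw [lintegral_congr e, lintegral_indicator (hB i), lintegral_const, Measure.restrict_apply MeasurableSet.univ,
          Set.univ_inter, Real.volume_closedBall, sq, mul_assoc,
          ENNReal.div_mul_cancel h0 ENNReal.ofReal_ne_top, ← ENNReal.mul_div_right_comm, ← sq,
          ← Real.volume_closedBall]
        exact ENNReal.div_le_of_le_mul
          (sq_lintegral_le_of_support (hg i hi).aemeasurable (hB i) (hs i hi))
    _ = I.card * ∫⁻ x, ∑ i ∈ I, g i x ^ 2 := by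
        rw [lintegral_finsetSum]
        exact fun i hi => (hg i hi).pow_const 2
    _ ≤ _ := by
        gcongr with x
        exact ENNReal.sum_sq_le_sq_sum I _

/-- Of two intervals that meet, the shorter one lies in the triple of the longer one. -/
theorem lintegral_sq_intervalSum_le_mul {R : ι → ℝ} (hR : ∀ i, 0 < R i)
    (hg : ∀ i ∈ I, Measurable (g i)) (hs : ∀ i ∈ I, ∀ x ∉ Metric.closedBall (c i) (R i), g i x = 0) :
    ∫⁻ x, intervalSum I c g R x ^ 2
      ≤ 6 * ∫⁻ x, intervalSum I c g (fun i => 3 * R i) x * ∑ i ∈ I, g i x := by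
  classical
  have hB : ∀ i, MeasurableSet (Metric.closedBall (c i) (R i)) :=
    fun i => Metric.isClosed_closedBall.measurableSet
  have hm : Measurable fun x => ∑ i ∈ I, g i x := Finset.measurable_fun_sum I hg
  set a : ι → ℝ≥0∞ := fun i => ∫⁻ y, g i y with ha
  set b : ι → ℝ≥0∞ := fun i => a i / ENNReal.ofReal (2 * R i) with hb
  let t : ι → ι → ℝ≥0∞ := fun i j =>
    if R i ≤ R j ∧ (Metric.closedBall (c i) (R i) ∩ Metric.closedBall (c j) (R j)).Nonempty
    then a i * b j else 0
  have hab : ∀ i, b i * ENNReal.ofReal (2 * R i) = a i := fun i =>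
    ENNReal.div_mul_cancel (by have := hR i; simp; linarith) ENNReal.ofReal_ne_top
  have key : ∀ i j, b i * b j * volume (Metric.closedBall (c i) (R i) ∩
      Metric.closedBall (c j) (R j)) ≤ t i j + t j i := by
    intro i j
    rcases Set.eq_empty_or_nonempty (Metric.closedBall (c i) (R i) ∩
      Metric.closedBall (c j) (R j)) with h | h
    · simp [h]
    · rcases le_total (R i) (R j) with hij | hij
      · refine le_trans ?_ (le_add_of_nonneg_right zero_le)
        simp only [t, hij, h, and_self, if_true]
        rw [← hab i, mul_right_comm]
        gcongr
        rw [← Real.volume_closedBall]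
        exact measure_mono Set.inter_subset_left
      · refine le_trans ?_ (le_add_of_nonneg_left zero_le)
        rw [Set.inter_comm] at h
        simp only [t, hij, h, and_self, if_true]
        rw [← hab j, mul_comm (b i), mul_right_comm]
        gcongr
        rw [← Real.volume_closedBall]
        exact measure_mono Set.inter_subset_right
  have ht : ∀ j, ∑ i ∈ I, t i j
      ≤ b j * ∫⁻ x in Metric.closedBall (c j) (3 * R j), ∑ i ∈ I, g i x := by
    intro j
    rw [lintegral_finsetSum _ hg, Finset.mul_sum]
    refine Finset.sum_le_sum fun i hi => ?_
    simp only [t]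
    split_ifs with h
    · obtain ⟨hij, x, hx1, hx2⟩ := h
      rw [mul_comm]
      gcongr
      rw [ha]
      refine le_of_eq (lintegral_eq_setLIntegral_of_support
        Metric.isClosed_closedBall.measurableSet fun y hy => hs i hi y fun hy' => hy ?_)
      rw [Metric.mem_closedBall] at *
      have := dist_triangle y (c i) (c j)
      have := dist_triangle (c i) x (c j)
      rw [dist_comm (c i) x] at this
      linarith
    · exact zero_le
  calc ∫⁻ x, intervalSum I c g R x ^ 2
      = ∑ i ∈ I, ∑ j ∈ I, b i * b j * volume (Metric.closedBall (c i) (R i) ∩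
          Metric.closedBall (c j) (R j)) := lintegral_sq_sum_indicator I b hB
    _ ≤ ∑ i ∈ I, ∑ j ∈ I, (t i j + t j i) :=
        Finset.sum_le_sum fun i _ => Finset.sum_le_sum fun j _ => key i j
    _ = 2 * ∑ j ∈ I, ∑ i ∈ I, t i j := by
        simp_rw [Finset.sum_add_distrib]
        rw [Finset.sum_comm, two_mul]
    _ ≤ 2 * ∑ j ∈ I, b j * ∫⁻ x in Metric.closedBall (c j) (3 * R j), ∑ i ∈ I, g i x := by
        gcongr with j
        exact ht j
    _ = 2 * ∑ j ∈ I, 3 * ((a j / ENNReal.ofReal (2 * (3 * R j))) *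
          ∫⁻ x in Metric.closedBall (c j) (3 * R j), ∑ i ∈ I, g i x) := by
        congr 1
        refine Finset.sum_congr rfl fun j _ => ?_
        rw [← mul_assoc]
        congr 1
        rw [hb, show 2 * (3 * R j) = 3 * (2 * R j) by ring, ENNReal.ofReal_mul (by norm_num),
          ← mul_div_assoc, show ENNReal.ofReal 3 = 3 by norm_num,
          ENNReal.mul_div_mul_left _ _ (by norm_num) (by norm_num)]
    _ = 6 * ∫⁻ x, intervalSum I c g (fun i => 3 * R i) x * ∑ i ∈ I, g i x := by
        unfold intervalSum
        rw [lintegral_sum_indicator_mul I _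
          (fun _ => Metric.isClosed_closedBall.measurableSet) hm.aemeasurable,
          ← Finset.mul_sum, ← mul_assoc, show (2 : ℝ≥0∞) * 3 = 6 by norm_num]

/-- A bounded sequence with `y k ^ 2 ≤ y (k + 1)` starts at most at `1`. -/
theorem le_one_of_sq_le_succ {y : ℕ → ℝ} (h : ∀ k, y k ^ 2 ≤ y (k + 1)) {M : ℝ}
    (hM : ∀ k, y k ≤ M) : y 0 ≤ 1 := by
  by_contra! h0
  have h1 : ∀ k, y 0 ^ (2 ^ k) ≤ y k := by
    intro k
    induction k with
    | zero => simp
    | succ k ih =>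
      rw [pow_succ, pow_mul]
      exact (pow_le_pow_left₀ (by positivity) ih 2).trans (h k)
  obtain ⟨n, hn⟩ := pow_unbounded_of_one_lt M h0
  have := (h1 n).trans (hM n)
  have h2 : y 0 ^ n ≤ y 0 ^ (2 ^ n) := pow_le_pow_right₀ h0.le Nat.lt_two_pow_self.le
  linarith

/-- The one-dimensional maximal theorem in `L²`, in dual form.  By the `TT*` estimate the norm `X R`
for the radii `R` and the norm `γ` of the sum of the `g i` satisfy `X R ^ 2 ≤ 6 * X (3 * R) * γ`.
Iterating this, and bounding the last term trivially in terms of the number of intervals, removes the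
dependence on that number. -/
theorem lintegral_sq_intervalSum_le {R : ι → ℝ} (hR : ∀ i, 0 < R i)
    (hg : ∀ i ∈ I, Measurable (g i)) (hs : ∀ i ∈ I, ∀ x ∉ Metric.closedBall (c i) (R i), g i x = 0) :
    ∫⁻ x, intervalSum I c g R x ^ 2 ≤ 36 * ∫⁻ x, (∑ i ∈ I, g i x) ^ 2 := by
  set G := ∫⁻ x, (∑ i ∈ I, g i x) ^ 2 with hG
  have hm : Measurable fun x => ∑ i ∈ I, g i x := Finset.measurable_fun_sum I hg
  have hR' : ∀ (k : ℕ) i, 0 < 3 ^ k * R i := fun k i => mul_pos (by positivity) (hR i)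
  have hs' : ∀ (k : ℕ), ∀ i ∈ I, ∀ x ∉ Metric.closedBall (c i) (3 ^ k * R i), g i x = 0 := by
    intro k i hi x hx
    refine hs i hi x fun h => hx (Metric.closedBall_subset_closedBall ?_ h)
    have : (1 : ℝ) ≤ 3 ^ k := one_le_pow₀ (by norm_num)
    have := hR i
    nlinarith
  set X : ℕ → ℝ≥0∞ := fun k => ∫⁻ x, intervalSum I c g (fun i => 3 ^ k * R i) x ^ 2 with hX
  have hcard : ∀ k, X k ≤ I.card * G := fun k =>
    lintegral_sq_intervalSum_le_card (hR' k) hg (hs' k)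
  have hstep : ∀ k, X k ^ 2 ≤ 36 * X (k + 1) * G := by
    intro k
    have h1 := lintegral_sq_intervalSum_le_mul (hR' k) hg (hs' k)
    have h2 := sq_lintegral_mul_le (μ := volume)
      (measurable_intervalSum I c g (fun i => 3 * (3 ^ k * R i))).aemeasurable hm.aemeasurable
    calc X k ^ 2 ≤ (6 * ∫⁻ x, intervalSum I c g (fun i => 3 * (3 ^ k * R i)) x * ∑ i ∈ I, g i x) ^ 2 := by
          gcongr
      _ ≤ 36 * ((∫⁻ x, intervalSum I c g (fun i => 3 * (3 ^ k * R i)) x ^ 2) * G) := by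
          rw [mul_pow, show (6 : ℝ≥0∞) ^ 2 = 36 by norm_num]; gcongr
      _ = _ := by
          simp only [hX, pow_succ' (3 : ℝ) k, mul_assoc]
  have h0 : X 0 ≤ 36 * G := by
    rcases eq_or_ne G ⊤ with hGt | hGt
    · simp [hGt]
    rcases eq_or_ne G 0 with hG0 | hG0
    · have := hcard 0
      simpa [hG0] using this
    have hXt : ∀ k, X k ≠ ⊤ := fun k =>
      ne_top_of_le_ne_top (ENNReal.mul_ne_top (by simp) hGt) (hcard k)
    have hGp : 0 < G.toReal := ENNReal.toReal_pos hG0 hGt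
    have := le_one_of_sq_le_succ (y := fun k => (X k).toReal / (36 * G.toReal)) (M := I.card / 36)
      (fun k => by
        have h := ENNReal.toReal_mono (by
          exact ENNReal.mul_ne_top (ENNReal.mul_ne_top (by norm_num) (hXt _)) hGt) (hstep k)
        simp only [ENNReal.toReal_pow, ENNReal.toReal_mul, ENNReal.toReal_ofNat] at h
        rw [div_pow, div_le_div_iff₀ (by positivity) (by positivity)]
        nlinarith [mul_le_mul_of_nonneg_right h hGp.le])
      (fun k => by
        have h := ENNReal.toReal_mono (ENNReal.mul_ne_top (by simp) hGt) (hcard k)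
        simp only [ENNReal.toReal_mul, ENNReal.toReal_natCast] at h
        rw [div_le_div_iff₀ (by positivity) (by positivity)]
        linarith)
    rw [div_le_one (by positivity)] at this
    rw [← ENNReal.toReal_le_toReal (hXt 0) (ENNReal.mul_ne_top (by norm_num) hGt)]
    simpa using this
  simpa [hX] using h0

end Interval

/-! ### Parallelograms with two vertical sides and the dual estimate -/

/-- The data of a parallelogram in `ℝ × ℝ` with two vertical sides of length `2 * wid` and two sides
of the given slope that project onto an interval of length `2 * len`. -/
structure Para where
  slope : ℝ
  center : ℝ × ℝ
  len : ℝ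
  wid : ℝ
  len_pos : 0 < len
  wid_pos : 0 < wid

namespace Para

/-- The closed parallelogram. -/
def toSet (P : Para) : Set (ℝ × ℝ) :=
  {y | |y.1 - P.center.1| ≤ P.len ∧ |y.2 - (P.center.2 + P.slope * (y.1 - P.center.1))| ≤ P.wid}

/-- The area of the parallelogram. -/
noncomputable def area (P : Para) : ℝ≥0∞ := ENNReal.ofReal (2 * P.len) * ENNReal.ofReal (2 * P.wid)

theorem isClosed_toSet (P : Para) : IsClosed P.toSet := by
  have h1 : IsClosed {y : ℝ × ℝ | |y.1 - P.center.1| ≤ P.len} :=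
    isClosed_le (by fun_prop) (by fun_prop)
  have h2 : IsClosed {y : ℝ × ℝ |
      |y.2 - (P.center.2 + P.slope * (y.1 - P.center.1))| ≤ P.wid} :=
    isClosed_le (by fun_prop) (by fun_prop)
  exact h1.inter h2

theorem measurableSet_toSet (P : Para) : MeasurableSet P.toSet := P.isClosed_toSet.measurableSet

theorem area_ne_zero (P : Para) : P.area ≠ 0 := by
  have := P.len_pos
  have := P.wid_pos
  simp [area]
  constructor <;> linarith

theorem area_ne_top (P : Para) : P.area ≠ ⊤ :=
  ENNReal.mul_ne_top ENNReal.ofReal_ne_top ENNReal.ofReal_ne_top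

theorem slice_of_mem {P : Para} {x : ℝ} (hx : |x - P.center.1| ≤ P.len) :
    Prod.mk x ⁻¹' P.toSet
      = Metric.closedBall (P.center.2 + P.slope * (x - P.center.1)) P.wid := by
  ext y
  simp [toSet, hx, Real.dist_eq]

theorem slice_of_notMem {P : Para} {x : ℝ} (hx : ¬ |x - P.center.1| ≤ P.len) :
    Prod.mk x ⁻¹' P.toSet = ∅ := by
  ext y
  simp [toSet, hx]

theorem volume_toSet (P : Para) : volume P.toSet = P.area := by
  rw [Measure.volume_eq_prod, Measure.prod_apply P.measurableSet_toSet]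
  have : ∀ x, volume (Prod.mk x ⁻¹' P.toSet)
      = (Metric.closedBall P.center.1 P.len).indicator (fun _ => ENNReal.ofReal (2 * P.wid)) x := by
    intro x
    by_cases hx : |x - P.center.1| ≤ P.len
    · rw [slice_of_mem hx, Set.indicator_of_mem (by simpa [Real.dist_eq] using hx),
        Real.volume_closedBall]
    · rw [slice_of_notMem hx, Set.indicator_of_notMem (by simpa [Real.dist_eq] using hx),
        measure_empty]
  simp_rw [this]
  rw [lintegral_indicator Metric.isClosed_closedBall.measurableSet, lintegral_const,
    Measure.restrict_apply MeasurableSet.univ, Set.univ_inter, Real.volume_closedBall, area, mul_comm]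

end Para

/-- The sum of the normalized indicators of the parallelograms `P i`, weighted by the masses of the
functions `g i`. -/
noncomputable def paraSum {ι : Type*} (I : Finset ι) (P : ι → Para) (g : ι → ℝ × ℝ → ℝ≥0∞)
    (x : ℝ × ℝ) : ℝ≥0∞ :=
  ∑ i ∈ I, (P i).toSet.indicator (fun _ => (∫⁻ y, g i y) / (P i).area) x

theorem measurable_paraSum {ι : Type*} (I : Finset ι) (P : ι → Para) (g : ι → ℝ × ℝ → ℝ≥0∞) :
    Measurable (paraSum I P g) :=
  Finset.measurable_fun_sum I fun i _ => measurable_const.indicator (P i).measurableSet_toSet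

/-- The dual form of the statement that the maximal operator over the parallelograms with slopes in
`T` has norm at most `B` on `L²`: the functions `g i` play the role of the pieces of a test function
on which the supremum is attained by the average over the parallelogram `P i`. -/
def DualBound (T : Set ℝ) (B : ℝ≥0) : Prop :=
  ∀ (ι : Type) (I : Finset ι) (P : ι → Para) (g : ι → ℝ × ℝ → ℝ≥0∞),
    (∀ i ∈ I, (P i).slope ∈ T) → (∀ i ∈ I, Measurable (g i)) →
    (∀ i ∈ I, ∀ x ∉ (P i).toSet, g i x = 0) →
    ∫⁻ x, paraSum I P g x ^ 2 ≤ (B : ℝ≥0∞) ^ 2 * ∫⁻ x, (∑ i ∈ I, g i x) ^ 2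

theorem DualBound.mono {S T : Set ℝ} {A B : ℝ≥0} (h : DualBound T A) (hST : S ⊆ T) (hAB : A ≤ B) :
    DualBound S B := fun ι I P g hP hg hs =>
  (h ι I P g (fun i hi => hST (hP i hi)) hg hs).trans (by gcongr)

/-- The strong maximal theorem: the one-dimensional estimate is applied first on vertical, then on
horizontal lines. -/
theorem dualBound_singleton_zero : DualBound {0} 36 := by
  intro ι I P g hP hg hs
  let c₁ : ι → ℝ := fun i => (P i).center.1
  let c₂ : ι → ℝ := fun i => (P i).center.2
  let L : ι → ℝ := fun i => (P i).len
  let W : ι → ℝ := fun i => (P i).wid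
  have hmem : ∀ i ∈ I, ∀ x y, (x, y) ∈ (P i).toSet ↔
      x ∈ Metric.closedBall (c₁ i) (L i) ∧ y ∈ Metric.closedBall (c₂ i) (W i) := by
    intro i hi x y
    have : (P i).slope = 0 := hP i hi
    simp [Para.toSet, this, c₁, c₂, L, W, Real.dist_eq]
  let h : ι → ℝ → ℝ → ℝ≥0∞ := fun i x y => (Metric.closedBall (c₂ i) (W i)).indicator
    (fun _ => (∫⁻ y', g i (x, y')) / ENNReal.ofReal (2 * W i)) y
  have hh : ∀ i ∈ I, Measurable fun p : ℝ × ℝ => h i p.1 p.2 := by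
    intro i hi
    have h1 : Measurable fun p : ℝ × ℝ => (∫⁻ y', g i (p.1, y')) / ENNReal.ofReal (2 * W i) :=
      (((hg i hi).lintegral_prod_right').comp measurable_fst).div_const _
    have h2 : MeasurableSet (Prod.snd ⁻¹' Metric.closedBall (c₂ i) (W i) : Set (ℝ × ℝ)) :=
      measurable_snd Metric.isClosed_closedBall.measurableSet
    exact h1.indicator h2
  have e1 : ∀ x y, ∑ i ∈ I, h i x y = intervalSum I c₂ (fun i y' => g i (x, y')) W y :=
    fun x y => rfl
  have e2 : ∀ x y, paraSum I P g (x, y) = intervalSum I c₁ (fun i x' => h i x' y) L x := by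
    intro x y
    refine Finset.sum_congr rfl fun i hi => ?_
    by_cases hx : x ∈ Metric.closedBall (c₁ i) (L i)
    · by_cases hy : y ∈ Metric.closedBall (c₂ i) (W i)
      · rw [Set.indicator_of_mem ((hmem i hi x y).2 ⟨hx, hy⟩), Set.indicator_of_mem hx]
        have : ∀ x', h i x' y = (∫⁻ y', g i (x', y')) / ENNReal.ofReal (2 * W i) := fun x' => by
          simp only [h]; rw [Set.indicator_of_mem hy]
        simp_rw [this, div_eq_mul_inv]
        rw [lintegral_mul_const _ ((hg i hi).lintegral_prod_right'), Measure.volume_eq_prod,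
          lintegral_prod _ (hg i hi).aemeasurable, Para.area, mul_assoc,
          ENNReal.mul_inv (Or.inr ENNReal.ofReal_ne_top) (Or.inl ENNReal.ofReal_ne_top),
          mul_comm (ENNReal.ofReal (2 * (P i).len))⁻¹]
      · rw [Set.indicator_of_notMem (fun H => hy ((hmem i hi x y).1 H).2), Set.indicator_of_mem hx]
        have : ∀ x', h i x' y = 0 := fun x' => by
          simp only [h]; rw [Set.indicator_of_notMem hy]
        simp [this]
    · rw [Set.indicator_of_notMem (fun H => hx ((hmem i hi x y).1 H).1), Set.indicator_of_notMem hx]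
  have hgm : Measurable fun p => ∑ i ∈ I, g i p := Finset.measurable_fun_sum I hg
  have hhm : Measurable fun p : ℝ × ℝ => ∑ i ∈ I, h i p.1 p.2 := Finset.measurable_fun_sum I hh
  calc ∫⁻ p, paraSum I P g p ^ 2
      = ∫⁻ y, ∫⁻ x, intervalSum I c₁ (fun i x' => h i x' y) L x ^ 2 := by
        rw [Measure.volume_eq_prod,
          lintegral_prod_symm _ ((measurable_paraSum I P g).pow_const 2).aemeasurable]
        simp_rw [e2]
    _ ≤ ∫⁻ y, 36 * ∫⁻ x, (∑ i ∈ I, h i x y) ^ 2 := by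
        refine lintegral_mono fun y => lintegral_sq_intervalSum_le (fun i => (P i).len_pos)
          (fun i hi => (hh i hi).comp (measurable_id.prodMk measurable_const)) ?_
        intro i hi x hx
        have : ∀ y', g i (x, y') = 0 := fun y' =>
          hs i hi _ fun H => hx ((hmem i hi x y').1 H).1
        simp [h, this]
    _ = 36 * ∫⁻ x, ∫⁻ y, (∑ i ∈ I, h i x y) ^ 2 := by
        rw [lintegral_const_mul' _ _ (by simp),
          lintegral_lintegral_swap (hhm.comp measurable_swap |>.pow_const 2).aemeasurable]
    _ ≤ 36 * ∫⁻ x, 36 * ∫⁻ y, (∑ i ∈ I, g i (x, y)) ^ 2 := by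
        refine mul_le_mul_right (lintegral_mono fun x => ?_) _
        simp_rw [e1]
        refine lintegral_sq_intervalSum_le (fun i => (P i).wid_pos)
          (fun i hi => (hg i hi).comp (measurable_const.prodMk measurable_id)) ?_
        intro i hi y hy
        exact hs i hi _ fun H => hy ((hmem i hi x y).1 H).2
    _ = _ := by
        rw [lintegral_const_mul' _ _ (by simp), ← mul_assoc, Measure.volume_eq_prod,
          lintegral_prod _ (hgm.pow_const 2).aemeasurable, sq ((36 : ℝ≥0) : ℝ≥0∞)]
        rfl

/-- A shear preserves the area and carries the slope `s` to any other slope. -/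
theorem measurePreserving_shear (s : ℝ) :
    MeasurePreserving (fun p : ℝ × ℝ => (p.1, p.2 + s * p.1)) volume volume := by
  rw [Measure.volume_eq_prod]
  refine (MeasurePreserving.id volume).skew_product (g := fun x y => y + s * x)
    (by unfold Function.uncurry; fun_prop) (Filter.Eventually.of_forall fun x => ?_)
  exact map_add_right_eq_self volume (s * x)

theorem dualBound_singleton (s : ℝ) : DualBound {s} 36 := by
  intro ι I P g hP hg hs
  have hΦ := measurePreserving_shear s
  set Φ : ℝ × ℝ → ℝ × ℝ := fun p => (p.1, p.2 + s * p.1) with hΦdef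
  let Q : ι → Para := fun i =>
    ⟨0, ((P i).center.1, (P i).center.2 - s * (P i).center.1), (P i).len, (P i).wid,
      (P i).len_pos, (P i).wid_pos⟩
  have hmem : ∀ i ∈ I, ∀ x, Φ x ∈ (P i).toSet ↔ x ∈ (Q i).toSet := by
    intro i hi x
    have : (P i).slope = s := hP i hi
    simp only [Para.toSet, Q, Φ, this, Set.mem_ofPred_eq]
    have e : x.2 + s * x.1 - ((P i).center.2 + s * (x.1 - (P i).center.1))
      = x.2 - ((P i).center.2 - s * (P i).center.1 + 0 * (x.1 - (P i).center.1)) := by ring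
    rw [e]
  have h := dualBound_singleton_zero ι I Q (fun i x => g i (Φ x)) (fun _ _ => rfl)
    (fun i hi => (hg i hi).comp hΦ.measurable)
    (fun i hi x hx => hs i hi _ fun H => hx ((hmem i hi x).1 H))
  have e : ∀ x, paraSum I Q (fun i x => g i (Φ x)) x = paraSum I P g (Φ x) := by
    intro x
    refine Finset.sum_congr rfl fun i hi => ?_
    have h1 : ∫⁻ y, g i (Φ y) = ∫⁻ y, g i y := hΦ.lintegral_comp (hg i hi)
    have h2 : (Q i).area = (P i).area := rfl
    by_cases hx : x ∈ (Q i).toSet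
    · rw [Set.indicator_of_mem hx, Set.indicator_of_mem ((hmem i hi x).2 hx), h1, h2]
    · rw [Set.indicator_of_notMem hx,
        Set.indicator_of_notMem fun H => hx ((hmem i hi x).1 H)]
  simp_rw [e] at h
  rwa [hΦ.lintegral_comp ((measurable_paraSum I P g).pow_const 2),
    hΦ.lintegral_comp ((Finset.measurable_fun_sum I hg).pow_const 2)] at h

theorem DualBound.of_subsingleton {T : Set ℝ} (hT : T.Subsingleton) : DualBound T 36 := by
  rcases hT.eq_empty_or_singleton with rfl | ⟨s, rfl⟩
  · exact (dualBound_singleton 0).mono (Set.empty_subset _) le_rfl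
  · exact dualBound_singleton s

theorem lintegral_sq_add_le {α : Type*} [MeasurableSpace α] {μ : Measure α} {f g : α → ℝ≥0∞}
    (hf : Measurable f) : ∫⁻ x, (f x + g x) ^ 2 ∂μ
      ≤ 2 * ∫⁻ x, f x ^ 2 ∂μ + 2 * ∫⁻ x, g x ^ 2 ∂μ := by
  calc ∫⁻ x, (f x + g x) ^ 2 ∂μ ≤ ∫⁻ x, (2 * f x ^ 2 + 2 * g x ^ 2) ∂μ := by
        refine lintegral_mono fun x => ?_
        have := ENNReal.sq_sum_le_card_mul Finset.univ ![f x, g x]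
        simpa [Fin.sum_univ_two, mul_add] using this
    _ = _ := by
        rw [lintegral_add_left ((hf.pow_const 2).const_mul 2), lintegral_const_mul' _ _ (by simp),
          lintegral_const_mul' _ _ (by simp)]

theorem DualBound.union {S T : Set ℝ} {A B : ℝ≥0} (hS : DualBound S A) (hT : DualBound T B) :
    DualBound (S ∪ T) (2 * (A + B)) := by
  classical
  intro ι I P g hP hg hs
  have h1 := hS ι (I.filter fun i => (P i).slope ∈ S) P g
    (fun i hi => (Finset.mem_filter.1 hi).2) (fun i hi => hg i (Finset.mem_filter.1 hi).1)
    (fun i hi => hs i (Finset.mem_filter.1 hi).1)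
  have h2 := hT ι (I.filter fun i => ¬ (P i).slope ∈ S) P g
    (fun i hi => ((hP i (Finset.mem_filter.1 hi).1).resolve_left (Finset.mem_filter.1 hi).2))
    (fun i hi => hg i (Finset.mem_filter.1 hi).1) (fun i hi => hs i (Finset.mem_filter.1 hi).1)
  set G := ∫⁻ x, (∑ i ∈ I, g i x) ^ 2
  have hle : ∀ J ⊆ I, ∫⁻ x, (∑ i ∈ J, g i x) ^ 2 ≤ G := fun J hJ => by
    refine lintegral_mono fun x => ?_
    gcongr
  have e : ∀ x, paraSum I P g x = paraSum (I.filter fun i => (P i).slope ∈ S) P g x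
      + paraSum (I.filter fun i => ¬ (P i).slope ∈ S) P g x := fun x =>
    (Finset.sum_filter_add_sum_filter_not I _ _).symm
  simp_rw [e]
  calc _ ≤ 2 * ((A : ℝ≥0∞) ^ 2 * G) + 2 * ((B : ℝ≥0∞) ^ 2 * G) := by
        refine (lintegral_sq_add_le (measurable_paraSum _ P g)).trans ?_
        gcongr
        · exact h1.trans (by gcongr; exact hle _ (Finset.filter_subset _ _))
        · exact h2.trans (by gcongr; exact hle _ (Finset.filter_subset _ _))
    _ = ((2 * A ^ 2 + 2 * B ^ 2 : ℝ≥0) : ℝ≥0∞) * G := by push_cast; ring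
    _ ≤ (((2 * (A + B)) ^ 2 : ℝ≥0) : ℝ≥0∞) * G := by
        gcongr
        rw [← NNReal.coe_le_coe]
        push_cast
        nlinarith [mul_nonneg A.coe_nonneg B.coe_nonneg, sq_nonneg (A : ℝ), sq_nonneg (B : ℝ)]
    _ = _ := by push_cast; rfl

/-! ### Intersections of two parallelograms -/

namespace Para

/-- A parallelogram of slope `ω` that contains `P` with room to spare. -/
noncomputable def turn (P : Para) (ω : ℝ) : Para where
  slope := ω
  center := P.center
  len := 2 * P.len
  wid := 3 * (P.wid + |P.slope - ω| * P.len)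
  len_pos := by have := P.len_pos; positivity
  wid_pos := by have := P.len_pos; have := P.wid_pos; positivity

theorem abs_sub_turn_le {P : Para} (ω : ℝ) {x : ℝ × ℝ} (hx : x ∈ P.toSet) :
    |x.2 - (P.center.2 + ω * (x.1 - P.center.1))| ≤ P.wid + |P.slope - ω| * P.len := by
  obtain ⟨h1, h2⟩ := hx
  calc |x.2 - (P.center.2 + ω * (x.1 - P.center.1))|
      = |(x.2 - (P.center.2 + P.slope * (x.1 - P.center.1)))
          + (P.slope - ω) * (x.1 - P.center.1)| := by ring_nf
    _ ≤ _ := (abs_add_le _ _).trans (by rw [abs_mul]; gcongr)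

theorem subset_turn (P : Para) (ω : ℝ) : P.toSet ⊆ (P.turn ω).toSet := by
  intro x hx
  have h := abs_sub_turn_le ω hx
  have h1 := hx.1
  have h2 := P.len_pos
  have h3 := P.wid_pos
  have h4 : 0 ≤ |P.slope - ω| * P.len := by positivity
  exact ⟨by simp only [turn]; linarith, by simp only [turn]; linarith⟩

theorem area_turn (P : Para) (ω : ℝ) : (P.turn ω).area * ENNReal.ofReal P.wid
    = 6 * ENNReal.ofReal (P.wid + |P.slope - ω| * P.len) * P.area := by
  have h2 := P.len_pos
  have h3 := P.wid_pos
  have h4 : 0 ≤ |P.slope - ω| * P.len := by positivity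
  simp only [area, turn]
  rw [show (6 : ℝ≥0∞) = ENNReal.ofReal 6 by norm_num]
  rw [← ENNReal.ofReal_mul (by positivity), ← ENNReal.ofReal_mul (by positivity),
    ← ENNReal.ofReal_mul (by positivity), ← ENNReal.ofReal_mul (by positivity),
    ← ENNReal.ofReal_mul (by positivity)]
  congr 1
  ring

theorem exists_abs_sub_le {x d L h : ℝ} (hx : |x - d| ≤ L) (h0 : 0 ≤ h) (hL : 2 * h ≤ L) :
    ∃ c, |c - x| ≤ h ∧ |c - d| ≤ L - h := by
  rw [abs_le] at hx
  rcases le_total x d with hxd | hxd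
  · refine ⟨x + h, ?_, ?_⟩ <;> rw [abs_le] <;> constructor <;> linarith
  · refine ⟨x - h, ?_, ?_⟩ <;> rw [abs_le] <;> constructor <;> linarith

theorem volume_inter_eq (P Q : Para) :
    volume (P.toSet ∩ Q.toSet) = ∫⁻ x, volume (Prod.mk x ⁻¹' (P.toSet ∩ Q.toSet)) := by
  rw [Measure.volume_eq_prod,
    Measure.prod_apply (P.measurableSet_toSet.inter Q.measurableSet_toSet)]

theorem volume_slice_le (P : Para) (x : ℝ) :
    volume (Prod.mk x ⁻¹' P.toSet) ≤ ENNReal.ofReal (2 * P.wid) := by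
  by_cases hx : |x - P.center.1| ≤ P.len
  · rw [slice_of_mem hx, Real.volume_closedBall]
  · simp [slice_of_notMem hx]

/-- If `Q` is at least as wide as the enlargement of `P`, the slices can be compared one by one. -/
theorem volume_inter_mul_le_of_wide {P Q : Para} {ω : ℝ}
    (hW : P.wid + |P.slope - ω| * P.len ≤ Q.wid) :
    volume (P.toSet ∩ Q.toSet) * ENNReal.ofReal (P.wid + |P.slope - ω| * P.len)
      ≤ ENNReal.ofReal (2 * P.wid) * volume ((P.turn ω).toSet ∩ Q.toSet) := by
  rw [volume_inter_eq, volume_inter_eq, ← lintegral_mul_const' _ _ ENNReal.ofReal_ne_top,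
    ← lintegral_const_mul' _ _ ENNReal.ofReal_ne_top]
  refine lintegral_mono fun x => ?_
  rcases Set.eq_empty_or_nonempty (Prod.mk x ⁻¹' (P.toSet ∩ Q.toSet)) with h | ⟨y, hyP, hyQ⟩
  · simp only [h, measure_empty, zero_mul, zero_le]
  · have h2 := P.len_pos
    have h3 := P.wid_pos
    have h4 : 0 ≤ |P.slope - ω| * P.len := by positivity
    refine mul_le_mul' ((measure_mono fun z hz => hz.1).trans (P.volume_slice_le x)) ?_
    set H := P.wid + |P.slope - ω| * P.len with hH
    obtain ⟨e, he1, he2⟩ := exists_abs_sub_le (h := H / 2) hyQ.2 (by positivity) (by linarith)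
    have h5 := abs_sub_turn_le ω hyP
    rw [← hH] at h5
    have : Metric.closedBall e (H / 2) ⊆ Prod.mk x ⁻¹' ((P.turn ω).toSet ∩ Q.toSet) := by
      intro z hz
      rw [Metric.mem_closedBall, Real.dist_eq] at hz
      refine ⟨⟨((subset_turn P ω) hyP).1, ?_⟩, ⟨hyQ.1, ?_⟩⟩
      · simp only [turn] at *
        rw [← hH]
        rw [abs_le] at *
        constructor <;> linarith [h5.1, h5.2, he1.1, he1.2, hz.1, hz.2]
      · simp only at *
        rw [abs_le] at *
        constructor <;> linarith [he2.1, he2.2, hz.1, hz.2]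
    refine le_trans ?_ (measure_mono this)
    rw [Real.volume_closedBall]
    apply ENNReal.ofReal_le_ofReal
    linarith

/-- Two strips whose slopes differ by `Δ` meet in a set of area at most a multiple of the product of
their widths divided by `Δ`. -/
theorem volume_inter_le_of_ne (P Q : Para) (h : P.slope ≠ Q.slope) :
    volume (P.toSet ∩ Q.toSet)
      ≤ ENNReal.ofReal (16 * P.wid * Q.wid / |P.slope - Q.slope|) := by
  have hΔ : 0 < |P.slope - Q.slope| := abs_pos.2 (sub_ne_zero.2 h)
  have hP := P.wid_pos
  have hQ := Q.wid_pos
  rcases Set.eq_empty_or_nonempty (P.toSet ∩ Q.toSet) with h0 | ⟨p, hpP, hpQ⟩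
  · simp [h0]
  set r := 2 * (P.wid + Q.wid) / |P.slope - Q.slope| with hr
  have hslice : ∀ x, volume (Prod.mk x ⁻¹' (P.toSet ∩ Q.toSet))
      ≤ (Metric.closedBall p.1 r).indicator
        (fun _ => ENNReal.ofReal (2 * min P.wid Q.wid)) x := by
    intro x
    rcases Set.eq_empty_or_nonempty (Prod.mk x ⁻¹' (P.toSet ∩ Q.toSet)) with h1 | ⟨y, hyP, hyQ⟩
    · simp [h1]
    · have hx : x ∈ Metric.closedBall p.1 r := by
        rw [Metric.mem_closedBall, Real.dist_eq, hr, le_div_iff₀ hΔ, ← abs_mul]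
        have a1 := abs_le.1 hpP.2
        have a2 := abs_le.1 hpQ.2
        have a3 := abs_le.1 hyP.2
        have a4 := abs_le.1 hyQ.2
        simp only at a1 a2 a3 a4
        rw [abs_le]
        constructor <;> linarith [a1.1, a1.2, a2.1, a2.2, a3.1, a3.2, a4.1, a4.2]
      rw [Set.indicator_of_mem hx, mul_min_of_nonneg _ _ (by norm_num), ENNReal.ofReal_min]
      exact le_min ((measure_mono fun z hz => hz.1).trans (P.volume_slice_le x))
        ((measure_mono fun z hz => hz.2).trans (Q.volume_slice_le x))
  calc volume (P.toSet ∩ Q.toSet)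
      ≤ ∫⁻ x, (Metric.closedBall p.1 r).indicator
        (fun _ => ENNReal.ofReal (2 * min P.wid Q.wid)) x := by
        rw [volume_inter_eq]
        exact lintegral_mono hslice
    _ = ENNReal.ofReal (2 * min P.wid Q.wid * (2 * r)) := by
        rw [lintegral_indicator Metric.isClosed_closedBall.measurableSet, lintegral_const,
          Measure.restrict_apply MeasurableSet.univ, Set.univ_inter, Real.volume_closedBall,
          ← ENNReal.ofReal_mul]
        have : 0 < min P.wid Q.wid := lt_min hP hQ
        positivity
    _ ≤ _ := by
        apply ENNReal.ofReal_le_ofReal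
        rw [hr, ← mul_div_assoc, ← mul_div_assoc]
        gcongr ?_ / _
        rcases le_total P.wid Q.wid with h | h
        · rw [min_eq_left h]; nlinarith
        · rw [min_eq_right h]; nlinarith

/-- A narrow strip `Q` crosses the enlargement of a shorter parallelogram `P` that it meets: the
intersection contains a parallelogram with the slope and the width of `Q`. -/
theorem le_volume_inter_of_narrow {P Q : Para} {ω ℓ : ℝ} (hl : 0 < ℓ) (hlP : ℓ ≤ P.len)
    (hPQ : P.len ≤ Q.len) (hne : (P.toSet ∩ Q.toSet).Nonempty)
    (hW : Q.wid ≤ P.wid + |P.slope - ω| * P.len)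
    (hs : |Q.slope - ω| * ℓ ≤ P.wid + |P.slope - ω| * P.len) :
    ENNReal.ofReal (ℓ * Q.wid) ≤ volume ((P.turn ω).toSet ∩ Q.toSet) := by
  obtain ⟨p, hpP, hpQ⟩ := hne
  have hQ := Q.wid_pos
  obtain ⟨c, hc1, hc2⟩ := exists_abs_sub_le (h := ℓ / 2) hpQ.1 (by positivity) (by linarith)
  have hv0 := hpQ.2
  set v₀ := p.2 - (Q.center.2 + Q.slope * (p.1 - Q.center.1)) with hv
  rw [← sub_zero v₀] at hv0
  obtain ⟨v, hv1, hv2⟩ := exists_abs_sub_le (h := Q.wid / 2) hv0 (by positivity) (by linarith)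
  rw [sub_zero] at hv2
  let D : Para := ⟨Q.slope, (c, Q.center.2 + Q.slope * (c - Q.center.1) + v), ℓ / 2, Q.wid / 2,
    by positivity, by positivity⟩
  have hD : D.area = ENNReal.ofReal (ℓ * Q.wid) := by
    simp only [area, D]
    rw [← ENNReal.ofReal_mul (by positivity)]
    congr 1
    ring
  have h5 := abs_sub_turn_le ω hpP
  set H := P.wid + |P.slope - ω| * P.len with hH
  rw [← hD, ← volume_toSet]
  refine measure_mono fun z hz => ?_
  obtain ⟨hz1, hz2⟩ := hz
  simp only [D] at hz1 hz2
  have e1 : |z.1 - p.1| ≤ ℓ := by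
    rw [abs_le] at *
    constructor <;> linarith [hz1.1, hz1.2, hc1.1, hc1.2]
  have e2 : |(Q.slope - ω) * (z.1 - p.1)| ≤ H := by
    rw [abs_mul]
    exact (mul_le_mul_of_nonneg_left e1 (abs_nonneg _)).trans hs
  have e3 : |z.2 - (Q.center.2 + Q.slope * (z.1 - Q.center.1)) - v| ≤ Q.wid / 2 := by
    convert hz2 using 2
    ring
  refine ⟨⟨?_, ?_⟩, ⟨?_, ?_⟩⟩
  · have := hpP.1
    simp only [turn]
    rw [abs_le] at *
    constructor <;> linarith [e1.1, e1.2, this.1, this.2]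
  · simp only [turn]
    rw [← hH, show z.2 - (P.center.2 + ω * (z.1 - P.center.1))
      = (z.2 - (Q.center.2 + Q.slope * (z.1 - Q.center.1)) - v) + (v - v₀)
        + (p.2 - (P.center.2 + ω * (p.1 - P.center.1))) + (Q.slope - ω) * (z.1 - p.1) by
      rw [hv]; ring]
    rw [abs_le] at *
    constructor <;> linarith [e2.1, e2.2, e3.1, e3.2, hv1.1, hv1.2, h5.1, h5.2]
  · rw [abs_le] at *
    constructor <;> linarith [hz1.1, hz1.2, hc2.1, hc2.2]
  · rw [abs_le] at *
    constructor <;> linarith [e3.1, e3.2, hv2.1, hv2.2]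

theorem volume_inter_mul_le {P Q : Para} {ω : ℝ} (hPQ : P.len ≤ Q.len)
    (hω : |P.slope - ω| ≤ 7 * |P.slope - Q.slope|) :
    volume (P.toSet ∩ Q.toSet) * ENNReal.ofReal (P.wid + |P.slope - ω| * P.len)
      ≤ ENNReal.ofReal (128 * P.wid) * volume ((P.turn ω).toSet ∩ Q.toSet) := by
  have hP := P.wid_pos
  have hQ := Q.wid_pos
  have hL := P.len_pos
  have h4 : 0 ≤ |P.slope - ω| * P.len := by positivity
  rcases Set.eq_empty_or_nonempty (P.toSet ∩ Q.toSet) with h0 | hne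
  · simp [h0]
  set H := P.wid + |P.slope - ω| * P.len with hH
  set Δ := |P.slope - Q.slope| with hΔ
  rcases le_or_gt (Δ * P.len) P.wid with hA | hA
  · rw [mul_comm]
    gcongr
    · nlinarith
    · exact subset_turn P ω
  rcases le_or_gt H Q.wid with hB | hB
  · refine (volume_inter_mul_le_of_wide hB).trans ?_
    gcongr
    norm_num
  · have hΔ0 : 0 < Δ := by
      by_contra! h
      nlinarith
    have hne' : P.slope ≠ Q.slope := fun h => by simp [hΔ, h] at hΔ0
    have hHpos : 0 < H := by positivity
    have hℓ : H / (8 * Δ) ≤ P.len := by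
      rw [div_le_iff₀ (by positivity)]
      nlinarith
    have hQω : |Q.slope - ω| ≤ 8 * Δ := by
      have := abs_sub_le Q.slope P.slope ω
      rw [abs_sub_comm Q.slope P.slope] at this
      linarith
    have h1 := le_volume_inter_of_narrow (ω := ω) (ℓ := H / (8 * Δ)) (by positivity) hℓ hPQ hne hB.le
      (by
        rw [← hH]
        calc |Q.slope - ω| * (H / (8 * Δ)) ≤ 8 * Δ * (H / (8 * Δ)) := by gcongr
          _ = H := by field_simp)
    calc volume (P.toSet ∩ Q.toSet) * ENNReal.ofReal H
        ≤ ENNReal.ofReal (16 * P.wid * Q.wid / Δ) * ENNReal.ofReal H := by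
          gcongr
          exact volume_inter_le_of_ne P Q hne'
      _ = ENNReal.ofReal (128 * P.wid) * ENNReal.ofReal (H / (8 * Δ) * Q.wid) := by
          rw [← ENNReal.ofReal_mul (by positivity), ← ENNReal.ofReal_mul (by positivity)]
          congr 1
          field_simp
          ring
      _ ≤ _ := by gcongr

/-- The geometric heart of the argument.  When the shorter parallelogram `P` of a pair is turned
into the direction `ω`, where `ω` is not much farther from the slope of `P` than the slope
of `Q` is, the average of the indicator of `Q` does not decrease by more than a constant factor. -/
theorem volume_inter_div_le {P Q : Para} {ω : ℝ} (hPQ : P.len ≤ Q.len)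
    (hω : |P.slope - ω| ≤ 7 * |P.slope - Q.slope|) :
    volume (P.toSet ∩ Q.toSet) / P.area
      ≤ 768 * (volume ((P.turn ω).toSet ∩ Q.toSet) / (P.turn ω).area) := by
  have h := volume_inter_mul_le hPQ hω
  have ha := area_turn P ω
  have hP := P.wid_pos
  have hL := P.len_pos
  have h4 : 0 ≤ |P.slope - ω| * P.len := by positivity
  have hHpos : 0 < P.wid + |P.slope - ω| * P.len := by positivity
  set H := P.wid + |P.slope - ω| * P.len with hH
  have hH0 : ENNReal.ofReal H ≠ 0 := by simpa using hHpos
  set A := volume (P.toSet ∩ Q.toSet)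
  set B := volume ((P.turn ω).toSet ∩ Q.toSet)
  rw [ENNReal.div_le_iff P.area_ne_zero P.area_ne_top]
  rw [← ENNReal.mul_le_mul_iff_left hH0 ENNReal.ofReal_ne_top]
  calc A * ENNReal.ofReal H ≤ ENNReal.ofReal (128 * P.wid) * B := h
    _ = 128 * B * ENNReal.ofReal P.wid := by
        rw [ENNReal.ofReal_mul (by norm_num), show ENNReal.ofReal 128 = 128 by norm_num]
        ring
    _ = 128 * (B / (P.turn ω).area) * ((P.turn ω).area * ENNReal.ofReal P.wid) := by
        rw [← mul_assoc, mul_assoc 128 (B / _), ENNReal.div_mul_cancel (area_ne_zero _) (area_ne_top _)]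
    _ = _ := by rw [ha]; ring

end Para

/-! ### The almost orthogonality principle -/

theorem sq_le_of_quadratic {x y₁ y₂ a b g k : ℝ} (hx : 0 ≤ x) (ha : 0 ≤ a) (hb : 0 ≤ b)
    (hg : 0 ≤ g) (hk : 0 ≤ k) (h : x ≤ a ^ 2 * g + k * (y₁ + y₂))
    (h₁ : y₁ ^ 2 ≤ b ^ 2 * g * x) (h₂ : y₂ ^ 2 ≤ b ^ 2 * g * x) :
    x ≤ (a + 2 * k * b) ^ 2 * g := by
  obtain ⟨s, hs, rfl⟩ : ∃ s, 0 ≤ s ∧ x = s ^ 2 := ⟨√x, Real.sqrt_nonneg _, (Real.sq_sqrt hx).symm⟩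
  obtain ⟨r, hr, rfl⟩ : ∃ r, 0 ≤ r ∧ g = r ^ 2 := ⟨√g, Real.sqrt_nonneg _, (Real.sq_sqrt hg).symm⟩
  have e₁ : y₁ ≤ b * r * s := le_of_sq_le_sq (by nlinarith) (by positivity)
  have e₂ : y₂ ≤ b * r * s := le_of_sq_le_sq (by nlinarith) (by positivity)
  have h' : s ^ 2 ≤ (a * r) ^ 2 + 2 * k * b * r * s := by
    nlinarith [mul_le_mul_of_nonneg_left (add_le_add e₁ e₂) hk]
  have hsr : s ≤ (a + 2 * k * b) * r := by
    by_contra! hlt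
    have h1 : 0 ≤ 2 * k * b * r := by positivity
    have h2 : a * r ≤ s := by nlinarith
    have h3 : 0 < s := lt_of_le_of_lt (by positivity) hlt
    have h4 : 0 ≤ a * r := by positivity
    nlinarith
  rw [← mul_pow]
  exact pow_le_pow_left₀ hs hsr 2

theorem lintegral_ne_top_of_support {P : Para} {g : ℝ × ℝ → ℝ≥0∞} (hg : Measurable g)
    (hs : ∀ x ∉ P.toSet, g x = 0) (h : ∫⁻ x, g x ^ 2 ≠ ⊤) : ∫⁻ x, g x ≠ ⊤ := by
  have h1 := sq_lintegral_le_of_support hg.aemeasurable (μ := volume) P.measurableSet_toSet hs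
  rw [P.volume_toSet] at h1
  intro htop
  rw [htop] at h1
  exact ENNReal.mul_ne_top h P.area_ne_top (top_le_iff.1 (by simpa using h1))

theorem lintegral_sq_paraSum_ne_top {ι : Type*} {I : Finset ι} {P : ι → Para}
    {g : ι → ℝ × ℝ → ℝ≥0∞} (hg : ∀ i ∈ I, Measurable (g i))
    (hs : ∀ i ∈ I, ∀ x ∉ (P i).toSet, g i x = 0) (h : ∫⁻ x, (∑ i ∈ I, g i x) ^ 2 ≠ ⊤) :
    ∫⁻ x, paraSum I P g x ^ 2 ≠ ⊤ := by
  unfold paraSum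
  rw [lintegral_sq_sum_indicator I _ fun i => (P i).measurableSet_toSet]
  have hb : ∀ i ∈ I, (∫⁻ y, g i y) / (P i).area ≠ ⊤ := fun i hi =>
    ENNReal.div_ne_top (lintegral_ne_top_of_support (hg i hi) (hs i hi) (ne_top_of_le_ne_top h
      (lintegral_mono fun x => by
        gcongr
        exact Finset.single_le_sum (f := fun i => g i x) (fun _ _ => zero_le) hi)))
      (P i).area_ne_zero
  refine ENNReal.sum_ne_top.2 fun i hi => ENNReal.sum_ne_top.2 fun k hk =>
    ENNReal.mul_ne_top (ENNReal.mul_ne_top (hb i hi) (hb k hk)) ?_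
  refine ne_top_of_le_ne_top ?_ (measure_mono Set.inter_subset_left)
  rw [(P i).volume_toSet]
  exact (P i).area_ne_top

/-- The part of the square of a sum that comes from pairs of equal class. -/
theorem sum_sum_ite_eq_class {ι β : Type*} [DecidableEq β] (I : Finset ι) (c : ι → β)
    (f : ι → ι → ℝ≥0∞) :
    ∑ i ∈ I, ∑ k ∈ I, (if c i = c k then f i k else 0)
      = ∑ b ∈ I.image c, ∑ i ∈ I.filter (fun i => c i = b), ∑ k ∈ I.filter (fun i => c i = b),
          f i k := by
  rw [← Finset.sum_fiberwise_of_maps_to (fun i hi => Finset.mem_image_of_mem c hi)]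
  refine Finset.sum_congr rfl fun b _ => Finset.sum_congr rfl fun i hi => ?_
  rw [Finset.sum_filter]
  refine Finset.sum_congr rfl fun k _ => ?_
  rw [(Finset.mem_filter.1 hi).2]
  simp only [eq_comm]

/-- Suppose that the slopes are divided into classes, for each of which the bound `A` holds, and that
each slope `x` has two reference slopes in `Z`, one of which is not much farther from `x`
than any given slope of another class.  Then the pairs of parallelograms of different classes cost
only the bound for `Z`, and the bound `A` keeps the factor `1`: the square of the sum over all
parallelograms is expanded, and the shorter one of each pair of different classes is turned into the
direction of its reference slope. -/
theorem DualBound.of_classes {T Z : Set ℝ} {A B : ℝ≥0} (hB : 0 < B) {β : Type*} (cls : ℝ → β)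
    (hcls : ∀ b, DualBound {x | x ∈ T ∧ cls x = b} A) (hZ : DualBound Z B)
    (href : ∀ x ∈ T, ∃ ω₁ ∈ Z, ∃ ω₂ ∈ Z, ∀ y ∈ T, cls x ≠ cls y →
      |x - ω₁| ≤ 7 * |x - y| ∨ |x - ω₂| ≤ 7 * |x - y|) :
    DualBound T (A + 3072 * B) := by
  classical
  intro ι I P g hP hg hs
  choose! ω₁ hω₁ ω₂ hω₂ hω using href
  set G := ∫⁻ x, (∑ i ∈ I, g i x) ^ 2 with hG
  rcases eq_or_ne G ⊤ with hGt | hGt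
  · rw [hGt, ENNReal.mul_top]
    · exact le_top
    · have : A + 3072 * B ≠ 0 := by positivity
      simpa using this
  set X := ∫⁻ x, paraSum I P g x ^ 2 with hX
  have hXt : X ≠ ⊤ := lintegral_sq_paraSum_ne_top hg hs hGt
  let P₁ : ι → Para := fun i => (P i).turn (ω₁ (P i).slope)
  let P₂ : ι → Para := fun i => (P i).turn (ω₂ (P i).slope)
  set a : ι → ℝ≥0∞ := fun i => ∫⁻ y, g i y with ha
  set b : ι → ℝ≥0∞ := fun i => a i / (P i).area with hb
  let c : ι → β := fun i => cls (P i).slope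
  let V : ι → ι → ℝ≥0∞ := fun i k => volume ((P i).toSet ∩ (P k).toSet)
  have hV : ∀ i k, V i k = V k i := fun i k => by simp only [V, Set.inter_comm]
  let Y : (ι → Para) → ℝ≥0∞ := fun Q => ∫⁻ x, paraSum I Q g x * paraSum I P g x
  have hY : ∀ Q : ι → Para, Y Q
      = ∑ i ∈ I, ∑ k ∈ I, a i * b k * (volume ((Q i).toSet ∩ (P k).toSet) / (Q i).area) := by
    intro Q
    refine (lintegral_sum_indicator_mul I _ (fun i => (Q i).measurableSet_toSet)
      (measurable_paraSum I P g).aemeasurable).trans (Finset.sum_congr rfl fun i _ => ?_)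
    unfold paraSum
    rw [lintegral_finsetSum _ fun k _ => measurable_const.indicator (P k).measurableSet_toSet,
      Finset.mul_sum]
    refine Finset.sum_congr rfl fun k _ => ?_
    rw [lintegral_indicator (P k).measurableSet_toSet, lintegral_const,
      Measure.restrict_apply MeasurableSet.univ, Set.univ_inter,
      Measure.restrict_apply (P k).measurableSet_toSet, Set.inter_comm]
    simp only [hb, ha, div_eq_mul_inv]
    ring
  have hYsq : ∀ ω : ℝ → ℝ, (∀ x ∈ T, ω x ∈ Z) →
      Y (fun i => (P i).turn (ω (P i).slope)) ^ 2 ≤ (B : ℝ≥0∞) ^ 2 * G * X := by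
    intro ω hωZ
    refine (sq_lintegral_mul_le (measurable_paraSum I _ g).aemeasurable
      (measurable_paraSum I P g).aemeasurable).trans ?_
    gcongr
    exact hZ ι I _ g (fun i hi => hωZ _ (hP i hi)) hg
      (fun i hi x hx => hs i hi x fun h => hx ((P i).subset_turn _ h))
  -- the pairs of equal class
  have hsame : ∑ i ∈ I, ∑ k ∈ I, (if c i = c k then b i * b k * V i k else 0)
      ≤ (A : ℝ≥0∞) ^ 2 * G := by
    rw [sum_sum_ite_eq_class]
    calc _ = ∑ β ∈ I.image c, ∫⁻ x, paraSum (I.filter fun i => c i = β) P g x ^ 2 := by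
          refine Finset.sum_congr rfl fun β _ => ?_
          unfold paraSum
          rw [lintegral_sq_sum_indicator _ _ fun i => (P i).measurableSet_toSet]
      _ ≤ ∑ β ∈ I.image c, (A : ℝ≥0∞) ^ 2 * ∫⁻ x, (∑ i ∈ I.filter fun i => c i = β, g i x) ^ 2 :=
          Finset.sum_le_sum fun β _ => hcls β ι _ P g
            (fun i hi => ⟨hP i (Finset.mem_filter.1 hi).1, (Finset.mem_filter.1 hi).2⟩)
            (fun i hi => hg i (Finset.mem_filter.1 hi).1)
            (fun i hi => hs i (Finset.mem_filter.1 hi).1)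
      _ = (A : ℝ≥0∞) ^ 2 * ∫⁻ x, ∑ β ∈ I.image c, (∑ i ∈ I.filter fun i => c i = β, g i x) ^ 2 := by
          rw [lintegral_finsetSum _ fun β _ => (Finset.measurable_fun_sum _ fun i hi =>
            hg i (Finset.mem_filter.1 hi).1).pow_const 2, Finset.mul_sum]
      _ ≤ _ := by
          refine mul_le_mul_right (lintegral_mono fun x => ?_) _
          refine (ENNReal.sum_sq_le_sq_sum _ _).trans (le_of_eq ?_)
          rw [Finset.sum_fiberwise_of_maps_to (fun i hi => Finset.mem_image_of_mem c hi)]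
  -- the pairs of different classes, the first one being the shorter one
  let t : ι → ι → ℝ≥0∞ := fun i k =>
    if c i ≠ c k ∧ (P i).len ≤ (P k).len then b i * b k * V i k else 0
  have ht : ∀ i ∈ I, ∀ k ∈ I, t i k ≤ 768 *
      (a i * b k * (volume ((P₁ i).toSet ∩ (P k).toSet) / (P₁ i).area)
        + a i * b k * (volume ((P₂ i).toSet ∩ (P k).toSet) / (P₂ i).area)) := by
    intro i hi k hk
    simp only [t]
    split_ifs with h
    · have e : b i * b k * V i k = a i * b k * (V i k / (P i).area) := by
        simp only [hb, div_eq_mul_inv]; ring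
      rw [e, ← mul_add, mul_left_comm]
      refine mul_le_mul_right ?_ _
      rcases hω _ (hP i hi) _ (hP k hk) h.1 with hc | hc
      · refine (Para.volume_inter_div_le h.2 hc).trans ?_
        gcongr
        exact le_add_of_nonneg_right zero_le
      · refine (Para.volume_inter_div_le h.2 hc).trans ?_
        gcongr
        exact le_add_of_nonneg_left zero_le
    · exact zero_le
  have hcross : ∑ i ∈ I, ∑ k ∈ I, (if c i = c k then 0 else b i * b k * V i k)
      ≤ 1536 * (Y P₁ + Y P₂) := by
    calc _ ≤ ∑ i ∈ I, ∑ k ∈ I, (t i k + t k i) := by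
          refine Finset.sum_le_sum fun i _ => Finset.sum_le_sum fun k _ => ?_
          split_ifs with h
          · exact zero_le
          · rcases le_total (P i).len (P k).len with hl | hl
            · refine le_trans ?_ (le_add_of_nonneg_right zero_le)
              simp [t, h, hl]
            · refine le_trans ?_ (le_add_of_nonneg_left zero_le)
              simp [t, Ne.symm (a := c i) h, hl, hV i k, mul_comm]
      _ = 2 * ∑ i ∈ I, ∑ k ∈ I, t i k := by
          simp_rw [Finset.sum_add_distrib]
          rw [two_mul]
          congr 1
          rw [Finset.sum_comm]
      _ ≤ 2 * ∑ i ∈ I, ∑ k ∈ I, 768 *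
            (a i * b k * (volume ((P₁ i).toSet ∩ (P k).toSet) / (P₁ i).area)
              + a i * b k * (volume ((P₂ i).toSet ∩ (P k).toSet) / (P₂ i).area)) := by
          refine mul_le_mul_right ?_ _
          exact Finset.sum_le_sum fun i hi => Finset.sum_le_sum fun k hk => ht i hi k hk
      _ = 1536 * (Y P₁ + Y P₂) := by
          rw [hY, hY, ← Finset.sum_add_distrib]
          simp_rw [← Finset.sum_add_distrib, ← Finset.mul_sum]
          rw [← mul_assoc]
          norm_num
  have hXle : X ≤ (A : ℝ≥0∞) ^ 2 * G + 1536 * (Y P₁ + Y P₂) := by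
    refine le_trans (le_of_eq ?_) (add_le_add hsame hcross)
    rw [hX]
    unfold paraSum
    rw [lintegral_sq_sum_indicator _ _ fun i => (P i).measurableSet_toSet,
      ← Finset.sum_add_distrib]
    refine Finset.sum_congr rfl fun i _ => ?_
    rw [← Finset.sum_add_distrib]
    refine Finset.sum_congr rfl fun k _ => ?_
    split_ifs <;> simp [V, hb, ha]
  have h₁ : Y P₁ ^ 2 ≤ (B : ℝ≥0∞) ^ 2 * G * X := hYsq ω₁ hω₁
  have h₂ : Y P₂ ^ 2 ≤ (B : ℝ≥0∞) ^ 2 * G * X := hYsq ω₂ hω₂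
  have hAt : (A : ℝ≥0∞) ^ 2 * G ≠ ⊤ := ENNReal.mul_ne_top (by simp) hGt
  have hBt : (B : ℝ≥0∞) ^ 2 * G * X ≠ ⊤ :=
    ENNReal.mul_ne_top (ENNReal.mul_ne_top (by simp) hGt) hXt
  have hY₁ : Y P₁ ≠ ⊤ := fun h => hBt (top_le_iff.1 (by simpa [h] using h₁))
  have hY₂ : Y P₂ ≠ ⊤ := fun h => hBt (top_le_iff.1 (by simpa [h] using h₂))
  have hS : (1536 : ℝ≥0∞) * (Y P₁ + Y P₂) ≠ ⊤ :=
    ENNReal.mul_ne_top (by simp) (ENNReal.add_ne_top.2 ⟨hY₁, hY₂⟩)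
  have r₀ := ENNReal.toReal_mono (ENNReal.add_ne_top.2 ⟨hAt, hS⟩) hXle
  have r₁ := ENNReal.toReal_mono hBt h₁
  have r₂ := ENNReal.toReal_mono hBt h₂
  rw [ENNReal.toReal_add hAt hS] at r₀
  simp only [ENNReal.toReal_mul, ENNReal.toReal_add hY₁ hY₂, ENNReal.toReal_pow,
    ENNReal.coe_toReal, ENNReal.toReal_ofNat] at r₀ r₁ r₂
  have := sq_le_of_quadratic ENNReal.toReal_nonneg A.coe_nonneg B.coe_nonneg
    ENNReal.toReal_nonneg (by norm_num) r₀ r₁ r₂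
  rw [← ENNReal.toReal_le_toReal hXt
    (ENNReal.mul_ne_top (ENNReal.pow_ne_top ENNReal.coe_ne_top) hGt)]
  simp only [ENNReal.toReal_mul, ENNReal.toReal_pow, ENNReal.coe_toReal, NNReal.coe_add,
    NNReal.coe_mul, NNReal.coe_ofNat]
  norm_num at this ⊢
  exact this

/-! ### Directions and angles -/

theorem dirOfAngle_add_int_mul (t : ℝ) (k : ℤ) :
    dirOfAngle (t + k * (2 * Real.pi)) = dirOfAngle t := by
  simp [dirOfAngle, Real.cos_add_int_mul_two_pi, Real.sin_add_int_mul_two_pi]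

theorem dirOfAngle_eq_iff {s t : ℝ} :
    dirOfAngle s = dirOfAngle t ↔ ∃ k : ℤ, s = t + k * (2 * Real.pi) := by
  constructor
  · intro h
    have h0 := congrArg (fun w : Plane => w 0) h
    have h1 := congrArg (fun w : Plane => w 1) h
    simp only [dirOfAngle, PiLp.toLp_apply, Matrix.cons_val_zero, Matrix.cons_val_one] at h0 h1
    have h2 := Real.Angle.cos_sin_inj h0 h1
    rw [Real.Angle.angle_eq_iff_two_pi_dvd_sub] at h2
    obtain ⟨k, hk⟩ := h2
    exact ⟨k, by linarith⟩
  · rintro ⟨k, rfl⟩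
    exact dirOfAngle_add_int_mul t k

theorem norm_dirOfAngle (t : ℝ) : ‖dirOfAngle t‖ = 1 := by
  simp [EuclideanSpace.norm_eq, dirOfAngle, Fin.sum_univ_two]

theorem exists_dirOfAngle_eq {w : Plane} (hw : ‖w‖ = 1) (s : ℝ) :
    ∃ t, s ≤ t ∧ t < s + 2 * Real.pi ∧ w = dirOfAngle t := by
  have h1 : w 0 ^ 2 + w 1 ^ 2 = 1 := by
    have := EuclideanSpace.norm_sq_eq w
    rw [hw, Fin.sum_univ_two] at this
    simpa using this.symm
  have hz : ‖(⟨w 0, w 1⟩ : ℂ)‖ = 1 := by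
    rw [← sq_eq_sq₀ (norm_nonneg _) zero_le_one, Complex.sq_norm, Complex.normSq_mk]
    linarith
  have hz0 : (⟨w 0, w 1⟩ : ℂ) ≠ 0 := fun h => by simp [h] at hz
  set θ := Complex.arg ⟨w 0, w 1⟩ with hθ
  have hw' : w = dirOfAngle θ := by
    ext i
    fin_cases i
    · simp [dirOfAngle, hθ, Complex.cos_arg hz0, hz]
    · simp [dirOfAngle, hθ, Complex.sin_arg, hz]
  have hmem := toIcoMod_mem_Ico Real.two_pi_pos s θ
  refine ⟨toIcoMod Real.two_pi_pos s θ, hmem.1, hmem.2, ?_⟩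
  rw [hw', dirOfAngle_eq_iff]
  refine ⟨toIcoDiv Real.two_pi_pos s θ, ?_⟩
  have := toIcoMod_add_toIcoDiv_zsmul Real.two_pi_pos s θ
  rw [zsmul_eq_mul] at this
  exact this.symm

theorem norm_dirOfAngle_sub (s t : ℝ) :
    ‖dirOfAngle s - dirOfAngle t‖ = 2 * |Real.sin ((s - t) / 2)| := by
  rw [← sq_eq_sq₀ (norm_nonneg _) (by positivity), EuclideanSpace.norm_sq_eq, Fin.sum_univ_two,
    mul_pow, sq_abs, Real.sin_sq_eq_half_sub, show 2 * ((s - t) / 2) = s - t by ring, Real.cos_sub]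
  simp only [dirOfAngle, PiLp.sub_apply, Real.norm_eq_abs, sq_abs,
    Matrix.cons_val_zero, Matrix.cons_val_one]
  nlinarith [Real.sin_sq_add_cos_sq s, Real.sin_sq_add_cos_sq t]

/-- The lift of an open arc to the line of angles, near a given angle. -/
theorem dirOfAngle_mem_openArc_iff {a b : Plane} {r : ℝ} :
    dirOfAngle r ∈ openArc a b ↔ ∃ s t : ℝ, s < r ∧ r < t ∧ t < s + 2 * Real.pi ∧
      a = dirOfAngle s ∧ b = dirOfAngle t := by
  constructor
  · rintro ⟨s, r', t, h1, h2, h3, ha, hr, hb⟩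
    obtain ⟨k, hk⟩ := dirOfAngle_eq_iff.1 hr
    exact ⟨s + k * (2 * Real.pi), t + k * (2 * Real.pi), by linarith, by linarith, by linarith,
      by rw [dirOfAngle_add_int_mul, ha], by rw [dirOfAngle_add_int_mul, hb]⟩
  · rintro ⟨s, t, h1, h2, h3, ha, hb⟩
    exact ⟨s, r, t, h1, h2, h3, ha, rfl, hb⟩

theorem notMem_of_disjoint_openArc {a b : Plane} {V : Set Plane} (h : Disjoint (openArc a b) V)
    {s t r : ℝ} (hst : t < s + 2 * Real.pi) (ha : a = dirOfAngle s) (hb : b = dirOfAngle t)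
    (h1 : s < r) (h2 : r < t) : dirOfAngle r ∉ V := fun hr =>
  Set.disjoint_left.1 h (dirOfAngle_mem_openArc_iff.2 ⟨s, t, h1, h2, hst, ha, hb⟩) hr

/-! ### Slopes of the directions in a small window -/

theorem tan_sub_tan_bounds {a b : ℝ} (ha : |a| ≤ 3 / 4) (hb : |b| ≤ 3 / 4) (hab : a ≤ b) :
    b - a ≤ Real.tan b - Real.tan a ∧ Real.tan b - Real.tan a ≤ 2 * (b - a) := by
  rw [abs_le] at ha hb
  have hpi := Real.pi_gt_three
  have hcos : ∀ x : ℝ, -(3 / 4) ≤ x → x ≤ 3 / 4 → 0 < Real.cos x ∧ 1 / 2 ≤ Real.cos x ^ 2 := by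
    intro x h1 h2
    have h3 : 0 < Real.cos x := Real.cos_pos_of_mem_Ioo ⟨by linarith, by linarith⟩
    refine ⟨h3, ?_⟩
    have h4 := Real.one_sub_sq_div_two_le_cos (x := x)
    have h5 : x ^ 2 ≤ 9 / 16 := by nlinarith
    have h6 : 23 / 32 ≤ Real.cos x := by linarith
    nlinarith
  obtain ⟨ha0, ha1⟩ := hcos a ha.1 ha.2
  obtain ⟨hb0, hb1⟩ := hcos b hb.1 hb.2
  have e : Real.tan b - Real.tan a = Real.sin (b - a) / (Real.cos a * Real.cos b) := by
    rw [Real.tan_eq_sin_div_cos, Real.tan_eq_sin_div_cos, Real.sin_sub]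
    field_simp
  have hprod : 0 < Real.cos a * Real.cos b := by positivity
  set x := b - a with hx
  have hx0 : 0 ≤ x := by linarith
  rw [e]
  constructor
  · rw [le_div_iff₀ hprod]
    have h1 : Real.cos a * Real.cos b ≤ Real.cos (x / 2) ^ 2 := by
      have h2 : Real.cos x = Real.cos b * Real.cos a + Real.sin b * Real.sin a := by
        rw [hx, Real.cos_sub]
      have h3 : Real.cos (b + a) ≤ 1 := Real.cos_le_one _
      rw [Real.cos_add] at h3
      rw [Real.cos_sq, show 2 * (x / 2) = x by ring]
      linarith
    have h2 : 0 < Real.cos (x / 2) := Real.cos_pos_of_mem_Ioo ⟨by linarith, by linarith⟩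
    have h3 : x / 2 ≤ Real.tan (x / 2) := Real.le_tan (by linarith) (by linarith)
    rw [Real.tan_eq_sin_div_cos, le_div_iff₀ h2] at h3
    have h4 : Real.sin x = 2 * Real.sin (x / 2) * Real.cos (x / 2) := by
      rw [← Real.sin_two_mul]; congr 1; ring
    nlinarith
  · rw [div_le_iff₀ hprod]
    have h1 : Real.sin x ≤ x := Real.sin_le hx0
    have h2 : 1 / 2 ≤ Real.cos a * Real.cos b := by
      by_contra! h
      have : (Real.cos a * Real.cos b) ^ 2 < 1 / 4 := by nlinarith
      nlinarith [mul_le_mul ha1 hb1 (by norm_num) (by positivity)]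
    nlinarith

/-- The slopes, relative to the direction of angle `α`, of the directions in `Ω` whose angle differs
from `α` by at most `1 / 16`. -/
def slopes (α : ℝ) (Ω : Set Plane) : Set ℝ :=
  {m | ∃ t, |t - α| ≤ 1 / 16 ∧ dirOfAngle t ∈ Ω ∧ m = Real.tan (t - α)}

theorem tan_sub_le_tan_sub_iff {α s t : ℝ} (hs : |s - α| ≤ 1 / 16) (ht : |t - α| ≤ 1 / 16) :
    Real.tan (s - α) ≤ Real.tan (t - α) ↔ s ≤ t := by
  have hpi := Real.pi_gt_three
  rw [abs_le] at hs ht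
  rw [Real.strictMonoOn_tan.le_iff_le ⟨by linarith, by linarith⟩ ⟨by linarith, by linarith⟩]
  constructor <;> intro h <;> linarith

theorem slopes_mono {α : ℝ} {V W : Set Plane} (h : V ⊆ W) : slopes α V ⊆ slopes α W := by
  rintro m ⟨t, h1, h2, h3⟩
  exact ⟨t, h1, h h2, h3⟩

theorem slopes_union_subset (α : ℝ) (V W : Set Plane) :
    slopes α (V ∪ W) ⊆ slopes α V ∪ slopes α W := by
  rintro m ⟨t, h1, h2 | h2, h3⟩
  · exact Or.inl ⟨t, h1, h2, h3⟩
  · exact Or.inr ⟨t, h1, h2, h3⟩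

theorem slopes_singleton_subsingleton (α : ℝ) (p : Plane) : (slopes α {p}).Subsingleton := by
  rintro _ ⟨s, hs, hs', rfl⟩ _ ⟨t, ht, ht', rfl⟩
  rw [Set.mem_singleton_iff] at hs' ht'
  obtain ⟨k, hk⟩ := dirOfAngle_eq_iff.1 (hs'.trans ht'.symm)
  have hpi := Real.pi_gt_three
  rw [abs_le] at hs ht
  have h1 : (k : ℝ) < 1 := by nlinarith
  have h2 : (-1 : ℝ) < k := by nlinarith
  have h3 : k = 0 := by
    have h1' : k < 1 := by exact_mod_cast h1
    have h2' : -1 < k := by exact_mod_cast h2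
    omega
  simp [hk, h3]

/-- The dual maximal estimate for the directions of `Ω` in each small window. -/
def AngularBound (Ω : Set Plane) (B : ℝ≥0) : Prop :=
  ∀ α, DualBound (slopes α Ω) B

theorem AngularBound.mono {V W : Set Plane} {A B : ℝ≥0} (h : AngularBound W A) (hVW : V ⊆ W)
    (hAB : A ≤ B) : AngularBound V B := fun α => (h α).mono (slopes_mono hVW) hAB

theorem AngularBound.union {V W : Set Plane} {A B : ℝ≥0} (hV : AngularBound V A)
    (hW : AngularBound W B) : AngularBound (V ∪ W) (2 * (A + B)) := fun α =>
  ((hV α).union (hW α)).mono (slopes_union_subset α V W) le_rfl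

theorem angularBound_singleton (p : Plane) : AngularBound {p} 36 := fun α =>
  DualBound.of_subsingleton (slopes_singleton_subsingleton α p)

/-! ### Sets of directions that are spread over the gaps of another set -/

/-- The cuts of `Z` on the two sides of `x`; they agree for `x` and `y ≠ x` if and only if no point
of `Z` lies in the closed interval between `x` and `y`. -/
def cutClass (Z : Set ℝ) (x : ℝ) : Set ℝ × Set ℝ := ({z | z ∈ Z ∧ z < x}, {z | z ∈ Z ∧ z ≤ x})

theorem cutClass_ne {Z : Set ℝ} {x y z : ℝ} (hz : z ∈ Z) (hxy : x < y) (h1 : x ≤ z) (h2 : z ≤ y) :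
    cutClass Z x ≠ cutClass Z y := by
  intro h
  rw [cutClass, cutClass, Prod.mk.injEq] at h
  rcases h2.lt_or_eq with h2 | rfl
  · have h3 : z ∈ {z | z ∈ Z ∧ z < y} := ⟨hz, h2⟩
    rw [← h.1] at h3
    exact absurd h3.2 (not_lt.2 h1)
  · have h3 : z ∈ {w | w ∈ Z ∧ w ≤ z} := ⟨hz, le_rfl⟩
    rw [← h.2] at h3
    exact absurd h3.2 (not_le.2 hxy)

theorem exists_mem_of_cutClass_ne {Z : Set ℝ} {x y : ℝ} (hxy : x < y)
    (h : cutClass Z x ≠ cutClass Z y) : ∃ z ∈ Z, x ≤ z ∧ z ≤ y := by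
  by_contra! hc
  apply h
  simp only [cutClass, Prod.mk.injEq]
  constructor
  · ext z
    exact ⟨fun hz => ⟨hz.1, hz.2.trans hxy⟩, fun hz => ⟨hz.1, by
      by_contra! h'
      exact absurd (hc z hz.1 h') (not_lt.2 hz.2.le)⟩⟩
  · ext z
    exact ⟨fun hz => ⟨hz.1, hz.2.trans hxy.le⟩, fun hz => ⟨hz.1, by
      by_contra! h'
      exact absurd (hc z hz.1 h'.le) (not_lt.2 hz.2)⟩⟩

/-- If the points of `W` outside `V` lie in arcs between points of `V`, then passing from the parts
of `W` in these arcs to `W` only adds a multiple of the bound for `V`: the end points of the arc of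
`x` separate `x` from the rest of `W`, so that they serve as its reference directions. -/
theorem AngularBound.of_arcs {V W : Set Plane} {A B : ℝ≥0} (hA : 36 ≤ A) (hV : AngularBound V B)
    (h : ∀ w ∈ W, w ∈ V ∨ ∃ a ∈ V, ∃ b ∈ V, w ∈ openArc a b ∧ Disjoint (openArc a b) V ∧
      AngularBound (W ∩ openArc a b) A) :
    AngularBound W (A + 3072 * (2 * (B + 36))) := by
  intro α
  have hmemZ : ∀ {u : ℝ}, |u - α| ≤ 1 / 16 → dirOfAngle u ∈ V → Real.tan (u - α) ∈ slopes α V :=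
    fun hu hu' => ⟨_, hu, hu', rfl⟩
  refine DualBound.of_classes (Z := slopes α V ∪ {0}) (by positivity) (cutClass (slopes α V))
    ?_ ((hV α).union (dualBound_singleton 0)) ?_
  · intro b
    rcases Set.eq_empty_or_nonempty {x | x ∈ slopes α W ∧ cutClass (slopes α V) x = b} with
      he | ⟨_, ⟨t, ht, htW, rfl⟩, hxb⟩
    · rw [he]
      exact (DualBound.of_subsingleton Set.subsingleton_empty).mono le_rfl hA
    have hcls : ∀ y, cutClass (slopes α V) y = b →
        ∀ z ∈ slopes α V, ¬ (Real.tan (t - α) < y ∧ Real.tan (t - α) ≤ z ∧ z ≤ y) ∧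
          ¬ (y < Real.tan (t - α) ∧ y ≤ z ∧ z ≤ Real.tan (t - α)) := by
      intro y hy z hz
      exact ⟨fun H => cutClass_ne hz H.1 H.2.1 H.2.2 (hxb.trans hy.symm),
        fun H => cutClass_ne hz H.1 H.2.1 H.2.2 (hy.trans hxb.symm)⟩
    rcases h _ htW with htV | ⟨a, ha, c, hc, harc, hdisj, hbd⟩
    · refine (DualBound.of_subsingleton ?_).mono le_rfl hA
      have key : ∀ y ∈ {x | x ∈ slopes α W ∧ cutClass (slopes α V) x = b},
          y = Real.tan (t - α) := by
        intro y hy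
        have := hcls y hy.2 _ (hmemZ ht htV)
        rcases lt_trichotomy y (Real.tan (t - α)) with h1 | h1 | h1
        · exact absurd ⟨h1, h1.le, le_rfl⟩ this.2
        · exact h1
        · exact absurd ⟨h1, le_rfl, h1.le⟩ this.1
      exact fun y hy z hz => (key y hy).trans (key z hz).symm
    · obtain ⟨s, u, hs, hu, hsu, rfl, rfl⟩ := dirOfAngle_mem_openArc_iff.1 harc
      refine (hbd α).mono ?_ le_rfl
      rintro _ ⟨⟨t', ht', htW', rfl⟩, hyb⟩
      refine ⟨t', ht', ⟨htW', dirOfAngle_mem_openArc_iff.2 ⟨s, u, ?_, ?_, hsu, rfl, rfl⟩⟩, rfl⟩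
      · by_contra! hlt
        have hs16 : |s - α| ≤ 1 / 16 := by
          rw [abs_le] at *; constructor <;> linarith [ht.1, ht.2, ht'.1, ht'.2]
        refine (hcls _ hyb _ (hmemZ hs16 ha)).2 ⟨?_, ?_, ?_⟩
        · rw [← not_le, tan_sub_le_tan_sub_iff ht ht']; linarith
        · rwa [tan_sub_le_tan_sub_iff ht' hs16]
        · rw [tan_sub_le_tan_sub_iff hs16 ht]; exact hs.le
      · by_contra! hlt
        have hu16 : |u - α| ≤ 1 / 16 := by
          rw [abs_le] at *; constructor <;> linarith [ht.1, ht.2, ht'.1, ht'.2]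
        refine (hcls _ hyb _ (hmemZ hu16 hc)).1 ⟨?_, ?_, ?_⟩
        · rw [← not_le, tan_sub_le_tan_sub_iff ht' ht]; linarith
        · rw [tan_sub_le_tan_sub_iff ht hu16]; exact hu.le
        · rwa [tan_sub_le_tan_sub_iff hu16 ht']
  · rintro _ ⟨t, ht, htW, rfl⟩
    rcases h _ htW with htV | ⟨a, ha, c, hc, harc, hdisj, -⟩
    · exact ⟨_, Or.inl (hmemZ ht htV), _, Or.inl (hmemZ ht htV), fun y _ _ => Or.inl (by simp)⟩
    obtain ⟨s, u, hs, hu, hsu, rfl, rfl⟩ := dirOfAngle_mem_openArc_iff.1 harc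
    have hend : ∀ r, dirOfAngle r ∈ V →
        ∃ ω ∈ slopes α V ∪ {0}, |r - α| ≤ 1 / 16 → ω = Real.tan (r - α) := by
      intro r hr
      by_cases h16 : |r - α| ≤ 1 / 16
      · exact ⟨_, Or.inl (hmemZ h16 hr), fun _ => rfl⟩
      · exact ⟨0, Or.inr rfl, fun h => absurd h h16⟩
    obtain ⟨ω₁, hω₁, h₁⟩ := hend s ha
    obtain ⟨ω₂, hω₂, h₂⟩ := hend u hc
    refine ⟨ω₁, hω₁, ω₂, hω₂, ?_⟩
    rintro _ ⟨t', ht', htW', rfl⟩ hne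
    rcases lt_trichotomy (Real.tan (t - α)) (Real.tan (t' - α)) with hlt | heq | hlt
    · right
      obtain ⟨_, ⟨τ, hτ, hτV, rfl⟩, hz1, hz2⟩ := exists_mem_of_cutClass_ne hlt hne
      rw [tan_sub_le_tan_sub_iff ht hτ] at hz1
      have huτ : u ≤ τ := by
        by_contra! hc'
        exact notMem_of_disjoint_openArc hdisj hsu rfl rfl (hs.trans_le hz1) hc' hτV
      have hu16 : |u - α| ≤ 1 / 16 := by
        rw [abs_le] at *; constructor <;> linarith [ht.1, ht.2, hτ.1, hτ.2]
      have e1 := (tan_sub_le_tan_sub_iff ht hu16).2 hu.le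
      have e2 := (tan_sub_le_tan_sub_iff hu16 hτ).2 huτ
      rw [h₂ hu16, abs_sub_comm, abs_of_nonneg (by linarith), abs_sub_comm,
        abs_of_nonneg (by linarith)]
      linarith
    · exact absurd (by rw [heq]) hne
    · left
      obtain ⟨_, ⟨τ, hτ, hτV, rfl⟩, hz1, hz2⟩ := exists_mem_of_cutClass_ne hlt hne.symm
      rw [tan_sub_le_tan_sub_iff hτ ht] at hz2
      have huτ : τ ≤ s := by
        by_contra! hc'
        exact notMem_of_disjoint_openArc hdisj hsu rfl rfl hc' (hz2.trans_lt hu) hτV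
      have hu16 : |s - α| ≤ 1 / 16 := by
        rw [abs_le] at *; constructor <;> linarith [ht.1, ht.2, hτ.1, hτ.2]
      have e1 := (tan_sub_le_tan_sub_iff hu16 ht).2 hs.le
      have e2 := (tan_sub_le_tan_sub_iff hτ hu16).2 huτ
      rw [h₁ hu16, abs_of_nonneg (by linarith), abs_of_nonneg (by linarith)]
      linarith

/-! ### One-lacunary sets -/

/-- `x` and `z` are consecutive terms of the sequence `v` up to its term of index `k`. -/
def ConsecutiveUpTo {X : Type*} (v : ℕ → X) (k : ℕ) (x z : X) : Prop :=
  ∃ j, j + 1 ≤ k ∧ ((x = v j ∧ z = v (j + 1)) ∨ (x = v (j + 1) ∧ z = v j))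

theorem ConsecutiveUpTo.mono {X : Type*} {v : ℕ → X} {k l : ℕ} (hkl : k ≤ l) {x z : X}
    (h : ConsecutiveUpTo v k x z) : ConsecutiveUpTo v l x z := by
  obtain ⟨j, hj, h⟩ := h
  exact ⟨j, hj.trans hkl, h⟩

/-- A walk on a graph whose vertices have degree at most two has used two edges at every vertex that
it has visited, with at most two exceptions.  By induction on the time: a new edge to a new
vertex has to start from an exceptional vertex, whose place is taken by the new vertex. -/
theorem exists_two_exceptions_upTo {X : Type*} {v : ℕ → X} (K : ℕ)
    (hdeg : ∀ x z₁ z₂ z₃, ConsecutiveUpTo v K x z₁ → ConsecutiveUpTo v K x z₂ →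
      ConsecutiveUpTo v K x z₃ → z₁ ≠ z₂ → z₁ ≠ z₃ → z₂ ≠ z₃ → False) :
    ∀ k ≤ K, ∃ p q, ∀ j ≤ k, v j ≠ p → v j ≠ q →
      ∃ z₁ z₂, z₁ ≠ z₂ ∧ ConsecutiveUpTo v k (v j) z₁ ∧ ConsecutiveUpTo v k (v j) z₂ := by
  intro k
  induction k with
  | zero =>
    intro _
    refine ⟨v 0, v 0, fun j hj h => ?_⟩
    obtain rfl : j = 0 := by omega
    exact absurd rfl h
  | succ k ih =>
    intro hkK
    obtain ⟨p, q, hpq⟩ := ih (by omega)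
    have hmono : ∀ j ≤ k, v j ≠ p → v j ≠ q → ∃ z₁ z₂, z₁ ≠ z₂ ∧
        ConsecutiveUpTo v (k + 1) (v j) z₁ ∧ ConsecutiveUpTo v (k + 1) (v j) z₂ := by
      intro j hj h1 h2
      obtain ⟨z₁, z₂, h, h3, h4⟩ := hpq j hj h1 h2
      exact ⟨z₁, z₂, h, h3.mono (Nat.le_succ k), h4.mono (Nat.le_succ k)⟩
    by_cases hold : ∃ j ≤ k, v (k + 1) = v j
    · obtain ⟨i, hi, hvi⟩ := hold
      refine ⟨p, q, fun j hj h1 h2 => ?_⟩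
      rcases Nat.lt_or_ge k j with hkj | hkj
      · obtain rfl : j = k + 1 := by omega
        rw [hvi] at h1 h2 ⊢
        exact hmono i hi h1 h2
      · exact hmono j hkj h1 h2
    · push Not at hold
      rcases Nat.eq_zero_or_pos k with rfl | hk
      · refine ⟨v 0, v 1, fun j hj h1 h2 => ?_⟩
        rcases Nat.lt_or_ge 0 j with h | h
        · obtain rfl : j = 1 := by omega
          exact absurd rfl h2
        · obtain rfl : j = 0 := by omega
          exact absurd rfl h1
      obtain ⟨l, rfl⟩ : ∃ l, k = l + 1 := ⟨k - 1, by omega⟩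
      have hcur : ∃ z₁ z₂, z₁ ≠ z₂ ∧ ConsecutiveUpTo v (l + 1 + 1) (v (l + 1)) z₁ ∧
          ConsecutiveUpTo v (l + 1 + 1) (v (l + 1)) z₂ :=
        ⟨v (l + 1 + 1), v l, hold l (by omega), ⟨l + 1, le_rfl, Or.inl ⟨rfl, rfl⟩⟩,
          ⟨l, by omega, Or.inr ⟨rfl, rfl⟩⟩⟩
      have hnew : ∀ p' q', (∀ j ≤ l + 1, v j ≠ p' → v j ≠ q' → v j = v (l + 1) ∨
          (v j ≠ p ∧ v j ≠ q)) → p' = v (l + 1 + 1) ∨ q' = v (l + 1 + 1) →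
          ∃ p q, ∀ j ≤ l + 1 + 1, v j ≠ p → v j ≠ q → ∃ z₁ z₂, z₁ ≠ z₂ ∧
            ConsecutiveUpTo v (l + 1 + 1) (v j) z₁ ∧ ConsecutiveUpTo v (l + 1 + 1) (v j) z₂ := by
        intro p' q' hp' hq'
        refine ⟨p', q', fun j hj h1 h2 => ?_⟩
        have hj' : j ≤ l + 1 := by
          by_contra! hlt
          obtain rfl : j = l + 1 + 1 := by omega
          rcases hq' with rfl | rfl
          · exact h1 rfl
          · exact h2 rfl
        rcases hp' j hj' h1 h2 with h | h
        · rw [h]; exact hcur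
        · exact hmono j hj' h.1 h.2
      by_cases h1 : v (l + 1) = p
      · exact hnew (v (l + 1 + 1)) q (fun j _ _ hq => by
          by_cases h : v j = p
          · exact Or.inl (h.trans h1.symm)
          · exact Or.inr ⟨h, hq⟩) (Or.inl rfl)
      by_cases h2 : v (l + 1) = q
      · exact hnew p (v (l + 1 + 1)) (fun j _ hp _ => by
          by_cases h : v j = q
          · exact Or.inl (h.trans h2.symm)
          · exact Or.inr ⟨hp, h⟩) (Or.inr rfl)
      exfalso
      obtain ⟨z₁, z₂, hz, hz₁, hz₂⟩ := hpq (l + 1) le_rfl h1 h2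
      have hne : ∀ z, ConsecutiveUpTo v (l + 1) (v (l + 1)) z → v (l + 1 + 1) ≠ z := by
        rintro z ⟨j, hj, ⟨-, rfl⟩ | ⟨-, rfl⟩⟩
        · exact hold _ (by omega)
        · exact hold _ (by omega)
      exact hdeg (v (l + 1)) (v (l + 1 + 1)) z₁ z₂ ⟨l + 1, hkK, Or.inl ⟨rfl, rfl⟩⟩
        (hz₁.mono (by omega)) (hz₂.mono (by omega)) (hne _ hz₁) (hne _ hz₂) hz

/-- The version of `exists_two_exceptions_upTo` for a finite or infinite sequence. -/
theorem exists_two_exceptions {X : Type*} {v : ℕ → X} {n : ℕ∞} {E : X → X → Prop}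
    (hE : ∀ j, ((j + 1 : ℕ) : ℕ∞) < n → E (v j) (v (j + 1)) ∧ E (v (j + 1)) (v j))
    (hdeg : ∀ x z₁ z₂ z₃, E x z₁ → E x z₂ → E x z₃ → z₁ ≠ z₂ → z₁ ≠ z₃ → z₂ ≠ z₃ → False) :
    ∃ p q, ∀ j : ℕ, (j : ℕ∞) < n → v j ≠ p → v j ≠ q → ∃ z₁ z₂, z₁ ≠ z₂ ∧ E (v j) z₁ ∧ E (v j) z₂ := by
  have hcons : ∀ K : ℕ, (K : ℕ∞) < n → ∀ x z, ConsecutiveUpTo v K x z → E x z := by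
    rintro K hK x z ⟨j, hj, h⟩
    have := hE j (lt_of_le_of_lt (by exact_mod_cast hj) hK)
    rcases h with ⟨rfl, rfl⟩ | ⟨rfl, rfl⟩
    · exact this.1
    · exact this.2
  by_contra! hcon
  obtain ⟨j₁, hj₁, -, -, hb₁⟩ := hcon (v 0) (v 0)
  obtain ⟨j₂, hj₂, h12, -, hb₂⟩ := hcon (v j₁) (v j₁)
  obtain ⟨j₃, hj₃, h13, h23, hb₃⟩ := hcon (v j₁) (v j₂)
  obtain ⟨K, hK, h1, h2, h3⟩ : ∃ K : ℕ, (K : ℕ∞) < n ∧ j₁ ≤ K ∧ j₂ ≤ K ∧ j₃ ≤ K := by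
    refine ⟨max j₁ (max j₂ j₃), ?_, le_max_left _ _, (le_max_left _ _).trans (le_max_right _ _),
      (le_max_right _ _).trans (le_max_right _ _)⟩
    exact max_lt hj₁ (max_lt hj₂ hj₃)
  obtain ⟨p, q, hpq⟩ := exists_two_exceptions_upTo K (fun x z₁ z₂ z₃ h1 h2 h3 =>
    hdeg x z₁ z₂ z₃ (hcons K hK _ _ h1) (hcons K hK _ _ h2) (hcons K hK _ _ h3)) K le_rfl
  have hmem : ∀ j ≤ K, (∀ z₁ z₂, z₁ ≠ z₂ → E (v j) z₁ → ¬ E (v j) z₂) → v j = p ∨ v j = q := by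
    intro j hj hb
    by_contra! hne
    obtain ⟨z₁, z₂, hz, hz₁, hz₂⟩ := hpq j hj hne.1 hne.2
    exact hb z₁ z₂ hz (hcons K hK _ _ hz₁) (hcons K hK _ _ hz₂)
  rcases hmem j₁ h1 hb₁ with e1 | e1 <;> rcases hmem j₂ h2 hb₂ with e2 | e2 <;>
    rcases hmem j₃ h3 hb₃ with e3 | e3 <;> simp_all

theorem IsGap.right_unique {Ω : Set Plane} (hΩ : ∀ w ∈ Ω, ‖w‖ = 1) {a b c : Plane}
    (hb : IsGap Ω a b) (hc : IsGap Ω a c) : b = c := by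
  obtain ⟨s, -, -, rfl⟩ := exists_dirOfAngle_eq (hΩ a hb.1) 0
  obtain ⟨t, ht1, ht2, rfl⟩ := exists_dirOfAngle_eq (hΩ b hb.2.1) s
  obtain ⟨u, hu1, hu2, rfl⟩ := exists_dirOfAngle_eq (hΩ c hc.2.1) s
  have ht1' : s < t := lt_of_le_of_ne ht1 fun h => hb.2.2.1 (by rw [h])
  have hu1' : s < u := lt_of_le_of_ne hu1 fun h => hc.2.2.1 (by rw [h])
  rcases lt_trichotomy t u with h | h | h
  · exact absurd hb.2.1 (notMem_of_disjoint_openArc hc.2.2.2 hu2 rfl rfl ht1' h)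
  · rw [h]
  · exact absurd hc.2.1 (notMem_of_disjoint_openArc hb.2.2.2 ht2 rfl rfl hu1' h)

theorem IsGap.left_unique {Ω : Set Plane} (hΩ : ∀ w ∈ Ω, ‖w‖ = 1) {a b c : Plane}
    (hb : IsGap Ω b a) (hc : IsGap Ω c a) : b = c := by
  obtain ⟨s, -, -, rfl⟩ := exists_dirOfAngle_eq (hΩ a hb.2.1) 0
  obtain ⟨t, ht1, ht2, rfl⟩ := exists_dirOfAngle_eq (hΩ b hb.1) (s - 2 * Real.pi)
  obtain ⟨u, hu1, hu2, rfl⟩ := exists_dirOfAngle_eq (hΩ c hc.1) (s - 2 * Real.pi)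
  have hs : dirOfAngle (s - 2 * Real.pi) = dirOfAngle s :=
    dirOfAngle_eq_iff.2 ⟨-1, by push_cast; ring⟩
  have ht1' : s - 2 * Real.pi < t := lt_of_le_of_ne ht1 fun h => hb.2.2.1 (by rw [← h, hs])
  have hu1' : s - 2 * Real.pi < u := lt_of_le_of_ne hu1 fun h => hc.2.2.1 (by rw [← h, hs])
  rcases lt_trichotomy t u with h | h | h
  · exact absurd hc.1 (notMem_of_disjoint_openArc hb.2.2.2 (by linarith) rfl rfl h (by linarith))
  · rw [h]
  · exact absurd hb.1 (notMem_of_disjoint_openArc hc.2.2.2 (by linarith) rfl rfl h (by linarith))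

theorem norm_dirOfAngle_sub_le_of_le {s t u : ℝ} (h1 : |s - t| ≤ |s - u|) (h2 : |s - u| ≤ 1) :
    ‖dirOfAngle s - dirOfAngle t‖ ≤ ‖dirOfAngle s - dirOfAngle u‖ := by
  have hpi := Real.pi_gt_three
  have key : ∀ x : ℝ, |x| ≤ 1 → |Real.sin (x / 2)| = Real.sin (|x| / 2) := by
    intro x hx
    rw [Real.abs_sin_eq_sin_abs_of_abs_le_pi (by rw [abs_div, abs_two]; linarith), abs_div, abs_two]
  rw [norm_dirOfAngle_sub, norm_dirOfAngle_sub, key _ (h1.trans h2), key _ h2]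
  have h3 := abs_nonneg (s - t)
  gcongr
  exact Real.sin_le_sin_of_le_of_le_pi_div_two (by linarith) (by linarith) (by linarith)

/-- If the two neighbors of `v` in `Ω` are not much closer to `v` than `c` is, then neither are the
other points of `Ω` near `v`. -/
theorem norm_sub_le_of_isGap {Ω : Set Plane} (hΩ : ∀ w ∈ Ω, ‖w‖ = 1) {z₁ z₂ c : Plane} {s t : ℝ}
    (h₁ : IsGap Ω (dirOfAngle s) z₁) (h₂ : IsGap Ω z₂ (dirOfAngle s))
    (hc₁ : ‖dirOfAngle s - c‖ ≤ 2 * ‖dirOfAngle s - z₁‖)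
    (hc₂ : ‖dirOfAngle s - c‖ ≤ 2 * ‖dirOfAngle s - z₂‖)
    (ht : dirOfAngle t ∈ Ω) (hst : s ≠ t) (hst1 : |s - t| ≤ 1) :
    ‖dirOfAngle s - c‖ ≤ 2 * ‖dirOfAngle s - dirOfAngle t‖ := by
  rcases lt_or_gt_of_ne hst with hlt | hlt
  · obtain ⟨u, hu1, hu2, rfl⟩ := exists_dirOfAngle_eq (hΩ z₁ h₁.2.1) s
    have hut : u ≤ t := by
      by_contra! hc
      exact notMem_of_disjoint_openArc h₁.2.2.2 hu2 rfl rfl hlt hc ht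
    refine hc₁.trans ?_
    gcongr
    apply norm_dirOfAngle_sub_le_of_le _ hst1
    rw [abs_sub_comm, abs_of_nonneg (by linarith), abs_sub_comm, abs_of_nonneg (by linarith)]
    linarith
  · obtain ⟨u, hu1, hu2, rfl⟩ := exists_dirOfAngle_eq (hΩ z₂ h₂.1) (s - 2 * Real.pi)
    have hut : t ≤ u := by
      by_contra! hc
      refine notMem_of_disjoint_openArc h₂.2.2.2 ?_ rfl rfl hc hlt ht
      refine lt_of_le_of_ne (by linarith) fun h => h₂.2.2.1 (dirOfAngle_eq_iff.2 ⟨-1, ?_⟩)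
      push_cast
      linarith
    refine hc₂.trans ?_
    gcongr
    apply norm_dirOfAngle_sub_le_of_le _ hst1
    rw [abs_of_nonneg (by linarith), abs_of_nonneg (by linarith)]
    linarith

/-- Within a small window, distances of directions are comparable to distances of slopes. -/
theorem abs_tan_sub_tan_le {α s t θ : ℝ} (hs : |s - α| ≤ 1 / 16) (ht : |t - α| ≤ 1 / 16)
    (h : ‖dirOfAngle s - dirOfAngle θ‖ ≤ 2 * ‖dirOfAngle s - dirOfAngle t‖) :
    |Real.tan (s - α) - Real.tan (θ - α)| ≤ 7 * |Real.tan (s - α) - Real.tan (t - α)| := by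
  have hpi := Real.pi_gt_three
  have hpi' := Real.pi_lt_d2
  -- the angle of the reference direction that is closest to `s`
  obtain ⟨θ', h1, h2, h3⟩ := exists_dirOfAngle_eq (norm_dirOfAngle θ) (s - Real.pi)
  have htan : Real.tan (θ - α) = Real.tan (θ' - α) := by
    obtain ⟨k, hk⟩ := dirOfAngle_eq_iff.1 h3
    rw [hk, show θ' + k * (2 * Real.pi) - α = θ' - α + ((2 * k : ℤ) : ℝ) * Real.pi by
      push_cast; ring, Real.tan_add_int_mul_pi]
  rw [htan]
  rw [h3, norm_dirOfAngle_sub, norm_dirOfAngle_sub] at h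
  have h4 : |(s - θ') / 2| ≤ Real.pi / 2 := by
    rw [abs_le]; constructor <;> linarith
  have h5 := Real.mul_abs_le_abs_sin h4
  have h6 : |Real.sin ((s - t) / 2)| ≤ |(s - t) / 2| := Real.abs_sin_le_abs
  rw [abs_div, abs_two] at h5 h6
  have h7 : |s - θ'| ≤ Real.pi * |s - t| := by
    have h8 : 2 / Real.pi * (|s - θ'| / 2) * Real.pi = |s - θ'| := by field_simp
    have h9 : 2 / Real.pi * (|s - θ'| / 2) ≤ |s - t| := by linarith
    nlinarith
  have h8 : |s - t| ≤ 1 / 8 := by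
    rw [abs_le] at *; constructor <;> linarith [hs.1, hs.2, ht.1, ht.2]
  have h9 : |s - θ'| ≤ 1 / 2 := by nlinarith [abs_nonneg (s - t)]
  have hθ : |θ' - α| ≤ 3 / 4 := by
    rw [abs_le] at hs h9 ⊢; constructor <;> linarith [hs.1, hs.2, h9.1, h9.2]
  have hbd : ∀ a b : ℝ, |a| ≤ 3 / 4 → |b| ≤ 3 / 4 →
      |a - b| ≤ |Real.tan a - Real.tan b| ∧ |Real.tan a - Real.tan b| ≤ 2 * |a - b| := by
    intro a b ha hb
    rcases le_total a b with hab | hab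
    · have := tan_sub_tan_bounds ha hb hab
      rw [abs_sub_comm, abs_of_nonneg (by linarith), abs_sub_comm, abs_of_nonneg (by linarith)]
      exact this
    · have := tan_sub_tan_bounds hb ha hab
      rw [abs_of_nonneg (by linarith), abs_of_nonneg (by linarith)]
      exact this
  have b1 := (hbd (s - α) (θ' - α) (hs.trans (by norm_num)) hθ).2
  have b2 := (hbd (s - α) (t - α) (hs.trans (by norm_num)) (ht.trans (by norm_num))).1
  rw [sub_sub_sub_cancel_right] at b1 b2
  nlinarith [abs_nonneg (s - t)]

/-- The bound for `1`-lacunary sets. -/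
noncomputable def oneLacunaryConst : ℝ≥0 := 36 + 3072 * (2 * (2 * (36 + 36) + 36))

/-- A `1`-lacunary set satisfies an absolute bound.  Except for two points, each point `v` of the set
has both of its neighbors next to it in the sequence, so that its distance to the limit
direction is at most twice its distance to any other point. -/
theorem IsOneLacunary.angularBound {V : Set Plane} (hV : IsOneLacunary V) :
    AngularBound V oneLacunaryConst := by
  obtain ⟨n, v, c, rfl, hv, hc, hk⟩ := hV
  set V : Set Plane := {w | ∃ k : ℕ, (k : ℕ∞) < n ∧ w = v k} with hVdef
  have hunit : ∀ w ∈ V, ‖w‖ = 1 := by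
    rintro _ ⟨k, hk, rfl⟩
    exact hv k hk
  obtain ⟨p, q, hpq⟩ := exists_two_exceptions (v := v) (n := n)
    (E := fun x z => AreNeighbors V x z ∧ ‖x - c‖ ≤ 2 * ‖x - z‖)
    (fun j hj => by
      obtain ⟨h1, -, h3⟩ := hk j hj
      refine ⟨⟨h1, ?_⟩, ⟨h1.symm, ?_⟩⟩
      · have := norm_sub_le_norm_sub_add_norm_sub (v j) (v (j + 1)) c
        linarith
      · rw [norm_sub_rev (v (j + 1)) (v j)]
        linarith [norm_nonneg (v j - v (j + 1))])
    (by
      rintro x z₁ z₂ z₃ ⟨h1 | h1, -⟩ ⟨h2 | h2, -⟩ ⟨h3 | h3, -⟩ h12 h13 h23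
      · exact h12 (h1.right_unique hunit h2)
      · exact h12 (h1.right_unique hunit h2)
      · exact h13 (h1.right_unique hunit h3)
      · exact h23 (h2.left_unique hunit h3)
      · exact h23 (h2.right_unique hunit h3)
      · exact h13 (h1.left_unique hunit h3)
      · exact h12 (h1.left_unique hunit h2)
      · exact h12 (h1.left_unique hunit h2))
  intro α
  obtain ⟨θ, -, -, rfl⟩ := exists_dirOfAngle_eq hc 0
  refine DualBound.of_classes (Z := {Real.tan (θ - α)} ∪ slopes α {p} ∪ slopes α {q})
    (by positivity) id (fun b => DualBound.of_subsingleton ?_)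
    (((dualBound_singleton _).union (angularBound_singleton p α)).union
      (angularBound_singleton q α)) ?_
  · rintro x ⟨-, hx⟩ y ⟨-, hy⟩
    exact hx.trans hy.symm
  rintro _ ⟨s, hs, ⟨k, hkn, hsk⟩, rfl⟩
  by_cases hp : v k = p
  · have hZ : Real.tan (s - α) ∈ {Real.tan (θ - α)} ∪ slopes α {p} ∪ slopes α {q} :=
      Or.inl (Or.inr ⟨s, hs, hsk.trans hp, rfl⟩)
    exact ⟨_, hZ, _, hZ, fun y _ _ => Or.inl (by simp)⟩
  by_cases hq : v k = q
  · have hZ : Real.tan (s - α) ∈ {Real.tan (θ - α)} ∪ slopes α {p} ∪ slopes α {q} :=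
      Or.inr ⟨s, hs, hsk.trans hq, rfl⟩
    exact ⟨_, hZ, _, hZ, fun y _ _ => Or.inl (by simp)⟩
  have hZ : Real.tan (θ - α) ∈ {Real.tan (θ - α)} ∪ slopes α {p} ∪ slopes α {q} :=
    Or.inl (Or.inl rfl)
  refine ⟨_, hZ, _, hZ, ?_⟩
  rintro _ ⟨t, ht, htV, rfl⟩ hne
  left
  refine abs_tan_sub_tan_le hs ht ?_
  have hst : s ≠ t := fun h => hne (by rw [h])
  have hst1 : |s - t| ≤ 1 := by
    rw [abs_le] at *; constructor <;> linarith [hs.1, hs.2, ht.1, ht.2]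
  obtain ⟨z₁, z₂, hz, ⟨hn₁, hc₁⟩, ⟨hn₂, hc₂⟩⟩ := hpq k hkn hp hq
  rw [← hsk] at hn₁ hc₁ hn₂ hc₂
  rcases hn₁ with h1 | h1 <;> rcases hn₂ with h2 | h2
  · exact absurd (h1.right_unique hunit h2) hz
  · exact norm_sub_le_of_isGap hunit h1 h2 hc₁ hc₂ htV hst hst1
  · exact norm_sub_le_of_isGap hunit h2 h1 hc₂ hc₁ htV hst hst1
  · exact absurd (h1.left_unique hunit h2) hz

/-! ### Lacunary sets of higher order -/

theorem norm_eq_one_of_mem_openArc {a b w : Plane} (h : w ∈ openArc a b) : ‖w‖ = 1 := by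
  obtain ⟨s, r, t, -, -, -, -, rfl, -⟩ := h
  exact norm_dirOfAngle r

theorem IsLacunary.norm_eq_one {N : ℕ} {Ω : Set Plane} (h : IsLacunary N Ω) :
    ∀ w ∈ Ω, ‖w‖ = 1 := by
  induction h with
  | one Ω h =>
    obtain ⟨n, v, c, rfl, hv, -⟩ := h
    rintro _ ⟨k, hk, rfl⟩
    exact hv k hk
  | succ N Ω Ω' _ _ hgap _ ih =>
    intro w hw
    by_cases hwΩ : w ∈ Ω
    · exact ih w hwΩ
    · obtain ⟨a, b, -, h⟩ := hgap w hw hwΩ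
      exact norm_eq_one_of_mem_openArc h

theorem IsLacunary.one_le {N : ℕ} {Ω : Set Plane} (h : IsLacunary N Ω) : 1 ≤ N := by
  cases h <;> omega

/-- A gap of a larger set that meets a gap of a smaller set is contained in it. -/
theorem IsGap.mem_of_mem_openArc {Ω Ω' : Set Plane} (hΩ : Ω ⊆ Ω') {a b a' b' w : Plane}
    (h : IsGap Ω' a b) (h' : IsGap Ω a' b') (hw : w ∈ openArc a b) (hw' : w ∈ openArc a' b') :
    a ∈ (Ω' ∩ openArc a' b') ∪ {a', b'} ∧ b ∈ (Ω' ∩ openArc a' b') ∪ {a', b'} := by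
  obtain ⟨s₀, r, t₀, -, -, -, -, rfl, -⟩ := id hw
  obtain ⟨s, t, h1, h2, h3, rfl, rfl⟩ := dirOfAngle_mem_openArc_iff.1 hw
  obtain ⟨s', t', h1', h2', h3', rfl, rfl⟩ := dirOfAngle_mem_openArc_iff.1 hw'
  have hs : s' ≤ s := by
    by_contra! hc
    exact notMem_of_disjoint_openArc h.2.2.2 h3 rfl rfl hc (h1'.trans h2) (hΩ h'.1)
  have ht : t ≤ t' := by
    by_contra! hc
    exact notMem_of_disjoint_openArc h.2.2.2 h3 rfl rfl (h1.trans h2') hc (hΩ h'.2.1)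
  constructor
  · rcases hs.eq_or_lt with rfl | hs
    · exact Or.inr (Or.inl rfl)
    · exact Or.inl ⟨h.1, dirOfAngle_mem_openArc_iff.2 ⟨s', t', hs, h1.trans h2', h3', rfl, rfl⟩⟩
  · rcases ht.eq_or_lt with rfl | ht
    · exact Or.inr (Or.inr rfl)
    · exact Or.inl ⟨h.2.1, dirOfAngle_mem_openArc_iff.2 ⟨s', t', h1'.trans h2, ht, h3', rfl, rfl⟩⟩

/-- If the points of `Ω'` outside `Ω` lie in gaps of `Ω`, then every gap of `Ω'` is contained in
a gap of `Ω`. -/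
theorem exists_isGap_of_isGap {Ω Ω' : Set Plane} (hΩ : Ω ⊆ Ω')
    (hgap : ∀ w ∈ Ω', w ∉ Ω → ∃ a b, IsGap Ω a b ∧ w ∈ openArc a b) {a b w : Plane}
    (h : IsGap Ω' a b) (hw : w ∈ openArc a b) : ∃ a' b', IsGap Ω a' b' ∧ w ∈ openArc a' b' := by
  obtain ⟨s₀, r, t₀, -, -, -, -, rfl, -⟩ := id hw
  obtain ⟨s, t, h1, h2, h3, rfl, rfl⟩ := dirOfAngle_mem_openArc_iff.1 hw
  by_cases ha : dirOfAngle s ∈ Ω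
  · by_cases hb : dirOfAngle t ∈ Ω
    · exact ⟨_, _, ⟨ha, hb, h.2.2.1, h.2.2.2.mono_right hΩ⟩, hw⟩
    · obtain ⟨a', b', h', hm⟩ := hgap _ h.2.1 hb
      obtain ⟨s', t', h1', h2', h3', rfl, rfl⟩ := dirOfAngle_mem_openArc_iff.1 hm
      have hs : s' ≤ s := by
        by_contra! hc
        exact notMem_of_disjoint_openArc h.2.2.2 h3 rfl rfl hc h1' (hΩ h'.1)
      exact ⟨_, _, h', dirOfAngle_mem_openArc_iff.2
        ⟨s', t', hs.trans_lt h1, h2.trans h2', h3', rfl, rfl⟩⟩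
  · obtain ⟨a', b', h', hm⟩ := hgap _ h.1 ha
    obtain ⟨s', t', h1', h2', h3', rfl, rfl⟩ := dirOfAngle_mem_openArc_iff.1 hm
    have ht : t ≤ t' := by
      by_contra! hc
      exact notMem_of_disjoint_openArc h.2.2.2 h3 rfl rfl h2' hc (hΩ h'.2.1)
    exact ⟨_, _, h', dirOfAngle_mem_openArc_iff.2
      ⟨s', t', h1'.trans h1, h2.trans_le ht, h3', rfl, rfl⟩⟩

/-- The loss when points are added in the arcs between the points of a `1`-lacunary set and at most
two more points. -/
noncomputable def levelConst : ℝ≥0 :=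
  3072 * (2 * (2 * (oneLacunaryConst + 2 * (36 + 36)) + 36))

/-- Adding points in the gaps of an `N`-lacunary set costs `N` times a constant.  The induction
removes the last level: inside a gap of the `N`-lacunary set below, the added points are spread over
the arcs between the points of a `1`-lacunary set and the end points of that gap. -/
theorem IsLacunary.angularBound_of_gaps {N : ℕ} {Ω : Set Plane} (h : IsLacunary N Ω) :
    ∀ (A : ℝ≥0), 36 ≤ A → ∀ Ω', Ω ⊆ Ω' →
      (∀ w ∈ Ω', w ∉ Ω → ∃ a b, IsGap Ω a b ∧ w ∈ openArc a b) →
      (∀ a b, IsGap Ω a b → AngularBound (Ω' ∩ openArc a b) A) →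
      AngularBound Ω' (A + N * levelConst) := by
  induction h with
  | one Ω h =>
    intro A hA Ω' _ hgap hbd
    refine (AngularBound.of_arcs (V := Ω) hA h.angularBound fun w hw => ?_).mono subset_rfl ?_
    · by_cases hwΩ : w ∈ Ω
      · exact Or.inl hwΩ
      · obtain ⟨a, b, hg, hm⟩ := hgap w hw hwΩ
        exact Or.inr ⟨a, hg.1, b, hg.2.1, hm, hg.2.2.2, hbd a b hg⟩
    · rw [Nat.cast_one, one_mul, levelConst]
      gcongr
      rw [two_mul]
      exact le_self_add.trans le_self_add
  | succ N Ω₀ Ω₁ _ hsub hgap hlac ih =>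
    intro A hA Ω' hΩ' hgap' hbd
    have hex : ∀ w ∈ Ω', w ∉ Ω₀ → ∃ a b, IsGap Ω₀ a b ∧ w ∈ openArc a b := by
      intro w hw hw₀
      by_cases hw₁ : w ∈ Ω₁
      · exact hgap w hw₁ hw₀
      · obtain ⟨a, b, hg, hm⟩ := hgap' w hw hw₁
        exact exists_isGap_of_isGap hsub hgap hg hm
    refine (ih (A + levelConst) (hA.trans le_self_add) Ω' (hsub.trans hΩ') hex ?_).mono
      subset_rfl (le_of_eq (by push_cast; ring))
    intro a' b' hg'
    have hV : AngularBound ((Ω₁ ∩ openArc a' b') ∪ {a', b'})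
        (2 * (oneLacunaryConst + 2 * (36 + 36))) :=
      (hlac a' b' hg').angularBound.union
        ((angularBound_singleton a').union (angularBound_singleton b'))
    refine (AngularBound.of_arcs hA hV fun w hw => ?_).mono subset_rfl le_rfl
    · by_cases hw₁ : w ∈ Ω₁
      · exact Or.inl (Or.inl ⟨hw₁, hw.2⟩)
      · obtain ⟨a, b, hg, hm⟩ := hgap' w hw.1 hw₁
        obtain ⟨ha, hb⟩ := hg.mem_of_mem_openArc hsub hg' hm hw.2
        refine Or.inr ⟨a, ha, b, hb, hm, hg.2.2.2.mono_right ?_, (hbd a b hg).mono ?_ le_rfl⟩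
        · rintro z (hz | rfl | rfl)
          · exact hz.1
          · exact hsub hg'.1
          · exact hsub hg'.2.1
        · exact Set.inter_subset_inter_left _ Set.inter_subset_left

theorem IsLacunary.angularBound {N : ℕ} {Ω : Set Plane} (h : IsLacunary N Ω) :
    AngularBound Ω (36 + N * levelConst) := by
  refine h.angularBound_of_gaps 36 le_rfl Ω subset_rfl (fun w hw hw' => absurd hw hw') ?_
  intro a b hg
  rw [Set.disjoint_iff_inter_eq_empty.1 hg.2.2.2.symm]
  exact (angularBound_singleton a).mono (Set.empty_subset _) le_rfl

/-! ### From the dual estimate to the maximal operator -/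

namespace Para

/-- The interior of the parallelogram. -/
def openSet (P : Para) : Set (ℝ × ℝ) :=
  {y | |y.1 - P.center.1| < P.len ∧ |y.2 - (P.center.2 + P.slope * (y.1 - P.center.1))| < P.wid}

theorem isOpen_openSet (P : Para) : IsOpen P.openSet := by
  have h1 : IsOpen {y : ℝ × ℝ | |y.1 - P.center.1| < P.len} :=
    isOpen_lt (by fun_prop) (by fun_prop)
  have h2 : IsOpen {y : ℝ × ℝ |
      |y.2 - (P.center.2 + P.slope * (y.1 - P.center.1))| < P.wid} :=
    isOpen_lt (by fun_prop) (by fun_prop)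
  exact h1.inter h2

theorem openSet_subset (P : Para) : P.openSet ⊆ P.toSet := fun _ h => ⟨h.1.le, h.2.le⟩

/-- The average of `f` over the parallelogram. -/
noncomputable def average (P : Para) (f : ℝ × ℝ → ℝ≥0∞) : ℝ≥0∞ := (∫⁻ y in P.toSet, f y) / P.area

theorem average_ne_top (P : Para) {f : ℝ × ℝ → ℝ≥0∞} (hf : Measurable f)
    (h : ∫⁻ x, f x ^ 2 ≠ ⊤) : P.average f ≠ ⊤ := by
  refine ENNReal.div_ne_top ?_ P.area_ne_zero
  rw [← lintegral_indicator P.measurableSet_toSet]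
  refine lintegral_ne_top_of_support (P := P) (hf.indicator P.measurableSet_toSet)
    (fun x hx => by simp [hx]) (ne_top_of_le_ne_top h (lintegral_mono fun x => ?_))
  gcongr
  exact Set.indicator_le_self _ _ x

end Para

theorem measurable_finset_sup {α ι : Type*} [MeasurableSpace α] [Countable ι] (I : Finset ι)
    {φ : ι → α → ℝ≥0∞} (hφ : ∀ i, Measurable (φ i)) : Measurable fun x => I.sup fun i => φ i x := by
  simp_rw [Finset.sup_eq_iSup]
  exact .iSup fun i => .iSup fun _ => hφ i

/-- The maximum of the averages over finitely many parallelograms, by duality: the test function is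
the maximum itself, split according to the first parallelogram at which it is attained. -/
theorem DualBound.lintegral_sq_sup_le {T : Set ℝ} {B : ℝ≥0} (h : DualBound T B) {P : ℕ → Para}
    (hP : ∀ i, (P i).slope ∈ T) {f : ℝ × ℝ → ℝ≥0∞} (hf : Measurable f)
    (hft : ∫⁻ x, f x ^ 2 ≠ ⊤) (n : ℕ) :
    ∫⁻ x, ((Finset.range n).sup fun i => (P i).toSet.indicator (fun _ => (P i).average f) x) ^ 2
      ≤ (B : ℝ≥0∞) ^ 2 * ∫⁻ x, f x ^ 2 := by
  set φ : ℕ → ℝ × ℝ → ℝ≥0∞ := fun i => (P i).toSet.indicator fun _ => (P i).average f with hφ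
  have hφm : ∀ i, Measurable (φ i) := fun i => measurable_const.indicator (P i).measurableSet_toSet
  set m : ℝ × ℝ → ℝ≥0∞ := fun x => (Finset.range n).sup fun i => φ i x with hm
  have hmm : Measurable m := measurable_finset_sup _ hφm
  let S : ℕ → Set (ℝ × ℝ) := fun i => {x | m x ≤ φ i x}
  have hS : ∀ i, MeasurableSet (S i) := fun i => measurableSet_le hmm (hφm i)
  let E : ℕ → Set (ℝ × ℝ) := fun i => S i \ ⋃ j ∈ Finset.range i, S j
  have hE : ∀ i, MeasurableSet (E i) := fun i =>
    (hS i).diff (Finset.measurableSet_biUnion _ fun j _ => hS j)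
  let g : ℕ → ℝ × ℝ → ℝ≥0∞ := fun i => (E i).indicator (φ i)
  have hgm : ∀ i, Measurable (g i) := fun i => (hφm i).indicator (hE i)
  have hgs : ∀ i, ∀ x ∉ (P i).toSet, g i x = 0 := by
    intro i x hx
    by_cases hxE : x ∈ E i <;> simp [g, φ, hxE, hx]
  -- at each point, exactly one of the functions `g i` is present, and it equals the maximum
  have hsum : ∀ x, n ≠ 0 → ∃ i ∈ Finset.range n, g i x = m x ∧ φ i x = m x ∧
      ∀ j ∈ Finset.range n, j ≠ i → g j x = 0 := by
    intro x hn
    classical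
    have hex : ∃ i, i ∈ Finset.range n ∧ x ∈ S i := by
      obtain ⟨i, hi, hi'⟩ := Finset.exists_mem_eq_sup (Finset.range n)
        (by simpa using hn) (fun i => φ i x)
      exact ⟨i, hi, hi'.le⟩
    obtain ⟨hi, hiS⟩ := Nat.find_spec hex
    have hmin := fun j => Nat.find_min hex (m := j)
    set i := Nat.find hex
    have hφi : φ i x = m x := le_antisymm (Finset.le_sup (f := fun i => φ i x) hi) hiS
    have hxE : x ∈ E i := by
      refine ⟨hiS, ?_⟩
      simp only [Set.mem_iUnion, not_exists]
      intro j hj hjS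
      rw [Finset.mem_range] at hj hi
      exact hmin j hj ⟨Finset.mem_range.2 (hj.trans hi), hjS⟩
    refine ⟨i, hi, by simp [g, hxE, hφi], hφi, fun j hj hji => ?_⟩
    refine Set.indicator_of_notMem (fun hjE => ?_) _
    rcases lt_or_gt_of_ne hji with hlt | hlt
    · exact hmin j hlt ⟨hj, hjE.1⟩
    · exact hjE.2 (Set.mem_biUnion (Finset.mem_coe.2 (Finset.mem_range.2 hlt)) hiS)
  rcases Nat.eq_zero_or_pos n with rfl | hn
  · simp
  have e1 : ∀ x, ∑ i ∈ Finset.range n, g i x = m x := by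
    intro x
    obtain ⟨i, hi, h1, -, h3⟩ := hsum x hn.ne'
    rw [Finset.sum_eq_single_of_mem i hi h3, h1]
  have e2 : ∀ x, ∑ i ∈ Finset.range n, (P i).average f * g i x = m x ^ 2 := by
    intro x
    obtain ⟨i, hi, h1, h2, h3⟩ := hsum x hn.ne'
    rw [Finset.sum_eq_single_of_mem i hi fun j hj hji => by rw [h3 j hj hji, mul_zero], h1, sq]
    by_cases hx : x ∈ (P i).toSet
    · rw [← h2]; simp [φ, hx]
    · rw [← h2]; simp [φ, hx]
  have hmt : ∫⁻ x, m x ^ 2 ≠ ⊤ := by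
    simp_rw [← e2]
    rw [lintegral_finsetSum _ fun i _ => (hgm i).const_mul _]
    refine ENNReal.sum_ne_top.2 fun i _ => ?_
    rw [lintegral_const_mul _ (hgm i)]
    refine ENNReal.mul_ne_top ((P i).average_ne_top hf hft) ?_
    refine ne_top_of_le_ne_top ?_ (lintegral_mono (Set.indicator_le_self (E i) (φ i)))
    rw [hφ, lintegral_indicator (P i).measurableSet_toSet, lintegral_const,
      Measure.restrict_apply MeasurableSet.univ, Set.univ_inter, (P i).volume_toSet]
    exact ENNReal.mul_ne_top ((P i).average_ne_top hf hft) (P i).area_ne_top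
  have hdual := h ℕ (Finset.range n) P g (fun i _ => hP i) (fun i _ => hgm i) (fun i _ => hgs i)
  simp_rw [e1] at hdual
  have hpair : ∫⁻ x, m x ^ 2 = ∫⁻ x, paraSum (Finset.range n) P g x * f x := by
    unfold paraSum
    rw [lintegral_sum_indicator_mul _ _ (fun i => (P i).measurableSet_toSet) hf.aemeasurable]
    simp_rw [← e2]
    rw [lintegral_finsetSum _ fun i _ => (hgm i).const_mul _]
    refine Finset.sum_congr rfl fun i _ => ?_
    rw [lintegral_const_mul _ (hgm i), Para.average]
    simp only [div_eq_mul_inv]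
    ring
  set M := ∫⁻ x, m x ^ 2 with hM
  have hsq : M * M ≤ ((B : ℝ≥0∞) ^ 2 * ∫⁻ x, f x ^ 2) * M := by
    calc M * M = (∫⁻ x, paraSum (Finset.range n) P g x * f x) ^ 2 := by rw [← hpair, sq]
      _ ≤ (∫⁻ x, paraSum (Finset.range n) P g x ^ 2) * ∫⁻ x, f x ^ 2 :=
        sq_lintegral_mul_le (measurable_paraSum _ _ _).aemeasurable hf.aemeasurable
      _ ≤ ((B : ℝ≥0∞) ^ 2 * M) * ∫⁻ x, f x ^ 2 := by gcongr
      _ = _ := by ring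
  rcases eq_or_ne M 0 with h0 | h0
  · rw [h0]; exact zero_le
  · exact (ENNReal.mul_le_mul_iff_left h0 hmt).1 hsq

/-- The maximal operator over the parallelograms with slopes in `T`.  A point counts only if it lies
in the interior, which makes the operator lower semicontinuous. -/
noncomputable def paraMax (T : Set ℝ) (f : ℝ × ℝ → ℝ≥0∞) (x : ℝ × ℝ) : ℝ≥0∞ :=
  ⨆ P : {P : Para // P.slope ∈ T}, P.1.openSet.indicator (fun _ => P.1.average f) x

theorem measurable_paraMax (T : Set ℝ) (f : ℝ × ℝ → ℝ≥0∞) : Measurable (paraMax T f) :=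
  (lowerSemicontinuous_iSup fun P : {P : Para // P.slope ∈ T} =>
    P.1.isOpen_openSet.lowerSemicontinuous_indicator zero_le).measurable

/-- By Lindelöf's theorem, countably many parallelograms suffice. -/
theorem exists_countable_paraMax_le (T : Set ℝ) (f : ℝ × ℝ → ℝ≥0∞) :
    ∃ C : Set Para, C.Countable ∧ (∀ P ∈ C, P.slope ∈ T) ∧
      ∀ x c, c < paraMax T f x → ∃ P ∈ C, x ∈ P.openSet ∧ c < P.average f := by
  let S : ℚ → Set Para := fun q => {P | P.slope ∈ T ∧ (Real.toNNReal q : ℝ≥0∞) < P.average f}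
  have hS : ∀ q, ∃ C ⊆ S q, C.Countable ∧ ⋃ P ∈ C, P.openSet = ⋃ P ∈ S q, P.openSet := fun q =>
    TopologicalSpace.isOpen_biUnion_countable (S q) Para.openSet fun P _ => P.isOpen_openSet
  choose C hC hCc hCU using hS
  refine ⟨⋃ q, C q, Set.countable_iUnion hCc, ?_, ?_⟩
  · intro P hP
    obtain ⟨q, hq⟩ := Set.mem_iUnion.1 hP
    exact (hC q hq).1
  · intro x c hc
    obtain ⟨⟨P, hPT⟩, hP⟩ := lt_iSup_iff.1 hc
    have hx : x ∈ P.openSet := by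
      by_contra hx
      simp [hx] at hP
    rw [Set.indicator_of_mem hx] at hP
    obtain ⟨q, -, hq1, hq2⟩ := ENNReal.lt_iff_exists_rat_btwn.1 hP
    have hmem : x ∈ ⋃ P ∈ S q, P.openSet := Set.mem_biUnion (⟨hPT, hq2⟩ : P ∈ S q) hx
    rw [← hCU q] at hmem
    obtain ⟨P', hP', hx'⟩ := Set.mem_iUnion₂.1 hmem
    exact ⟨P', Set.mem_iUnion.2 ⟨q, hP'⟩, hx', hq1.trans (hC q hP').2⟩

theorem DualBound.lintegral_sq_paraMax_le {T : Set ℝ} {B : ℝ≥0} (h : DualBound T B)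
    {f : ℝ × ℝ → ℝ≥0∞} (hf : Measurable f) (hft : ∫⁻ x, f x ^ 2 ≠ ⊤) :
    ∫⁻ x, paraMax T f x ^ 2 ≤ (B : ℝ≥0∞) ^ 2 * ∫⁻ x, f x ^ 2 := by
  obtain ⟨C, hCc, hCT, hC⟩ := exists_countable_paraMax_le T f
  rcases C.eq_empty_or_nonempty with rfl | hne
  · have : ∀ x, paraMax T f x = 0 := by
      intro x
      by_contra h0
      obtain ⟨P, hP, -⟩ := hC x 0 (pos_iff_ne_zero.2 h0)
      exact hP
    simp [this]
  obtain ⟨P, rfl⟩ := hCc.exists_eq_range hne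
  set m : ℕ → ℝ × ℝ → ℝ≥0∞ := fun n x =>
    (Finset.range n).sup fun i => (P i).toSet.indicator (fun _ => (P i).average f) x with hm
  have hmm : ∀ n, Measurable (m n) := fun n =>
    measurable_finset_sup _ fun i => measurable_const.indicator (P i).measurableSet_toSet
  have hmono : Monotone fun n x => m n x ^ 2 := by
    intro k l hkl x
    simp only [hm]
    gcongr
  have hle : ∀ x, paraMax T f x ^ 2 ≤ ⨆ n, m n x ^ 2 := by
    intro x
    have h1 : paraMax T f x ≤ ⨆ n, m n x := by
      refine le_of_forall_lt fun c hc => ?_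
      obtain ⟨_, ⟨i, rfl⟩, hx, hlt⟩ := hC x c hc
      refine hlt.trans_le (le_trans ?_ (le_iSup (fun n => m n x) (i + 1)))
      refine le_trans (le_of_eq ?_) (Finset.le_sup (f := fun i =>
        (P i).toSet.indicator (fun _ => (P i).average f) x) (Finset.self_mem_range_succ i))
      rw [Set.indicator_of_mem ((P i).openSet_subset hx)]
    refine (pow_le_pow_left' h1 2).trans (le_of_eq ?_)
    exact Monotone.map_iSup_of_continuousAt (f := fun a : ℝ≥0∞ => a ^ 2)
      (ENNReal.continuous_pow 2).continuousAt (fun a b hab => by dsimp only; gcongr) (by simp)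
  calc ∫⁻ x, paraMax T f x ^ 2 ≤ ∫⁻ x, ⨆ n, m n x ^ 2 := lintegral_mono hle
    _ = ⨆ n, ∫⁻ x, m n x ^ 2 := lintegral_iSup (fun n => (hmm n).pow_const 2) hmono
    _ ≤ _ := iSup_le fun n => h.lintegral_sq_sup_le (fun i => hCT _ ⟨i, rfl⟩) hf hft n

/-! ### Rectangles in a rotated frame -/

theorem inner_dirOfAngle (y : Plane) (t : ℝ) :
    inner ℝ y (dirOfAngle t) = y 0 * Real.cos t + y 1 * Real.sin t := by
  simp [PiLp.inner_apply, Fin.sum_univ_two, dirOfAngle, mul_comm]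

theorem inner_rotQuarter_dirOfAngle (y : Plane) (t : ℝ) :
    inner ℝ y (rotQuarter (dirOfAngle t)) = y 1 * Real.cos t - y 0 * Real.sin t := by
  simp [PiLp.inner_apply, Fin.sum_univ_two, dirOfAngle, rotQuarter]
  ring

theorem rotQuarter_dirOfAngle (t : ℝ) :
    rotQuarter (dirOfAngle t) = dirOfAngle (t + Real.pi / 2) := by
  ext i
  fin_cases i <;> simp [rotQuarter, dirOfAngle, Real.cos_add_pi_div_two, Real.sin_add_pi_div_two]

/-- The coordinates with respect to the orthonormal frame whose first vector has the angle `β`. -/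
noncomputable def frame (β : ℝ) (y : Plane) : ℝ × ℝ :=
  (inner ℝ y (dirOfAngle β), inner ℝ y (rotQuarter (dirOfAngle β)))

theorem exists_measurableEquiv_frame (β : ℝ) :
    ∃ e : Plane ≃ᵐ ℝ × ℝ, MeasurePreserving e volume volume ∧ ∀ y, e y = frame β y := by
  have hon : Orthonormal ℝ ![dirOfAngle β, dirOfAngle (β + Real.pi / 2)] := by
    rw [orthonormal_iff_ite]
    intro i j
    fin_cases i <;> fin_cases j
    · simp [norm_dirOfAngle]
    · simp [inner_dirOfAngle]
      simp [dirOfAngle, Real.cos_add_pi_div_two, Real.sin_add_pi_div_two, mul_comm]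
    · simp [inner_dirOfAngle]
      simp [dirOfAngle, Real.cos_add_pi_div_two, Real.sin_add_pi_div_two, mul_comm]
    · simp [norm_dirOfAngle]
  let b : OrthonormalBasis (Fin 2) ℝ Plane := OrthonormalBasis.mk hon
    (hon.linearIndependent.span_eq_top_of_card_eq_finrank' (by simp)).ge
  let e : Plane ≃ᵐ ℝ × ℝ :=
    (b.measurableEquiv.trans (MeasurableEquiv.toLp 2 (Fin 2 → ℝ)).symm).trans
      MeasurableEquiv.finTwoArrow
  refine ⟨e, ?_, fun y => ?_⟩
  · exact ((volume_preserving_finTwoArrow ℝ).comp (PiLp.volume_preserving_ofLp (Fin 2))).comp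
      b.measurePreserving_repr
  · have h : e y = ((b.repr y) 0, (b.repr y) 1) := rfl
    rw [h, b.repr_apply_apply, b.repr_apply_apply, frame, rotQuarter_dirOfAngle]
    simp [b, real_inner_comm]

theorem rectangle_eq_preimage (t : ℝ) (c : Plane) {p q : ℝ} (hp : 0 < p) (hq : 0 < q) :
    rectangle (dirOfAngle t) c p q = frame t ⁻¹' (⟨0, frame t c, p, q, hp, hq⟩ : Para).toSet := by
  ext y
  simp [rectangle, Para.toSet, frame, inner_sub_left]

theorem volume_rectangle (t : ℝ) (c : Plane) {p q : ℝ} (hp : 0 < p) (hq : 0 < q) :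
    volume (rectangle (dirOfAngle t) c p q) = ENNReal.ofReal (4 * p * q) := by
  obtain ⟨e, he, hef⟩ := exists_measurableEquiv_frame t
  have : frame t = e := funext fun y => (hef y).symm
  rw [rectangle_eq_preimage t c hp hq, this,
    he.measure_preimage (Para.measurableSet_toSet _).nullMeasurableSet, Para.volume_toSet,
    Para.area, ← ENNReal.ofReal_mul (by positivity)]
  congr 1
  ring

theorem rectangle_add_pi_div_two (t : ℝ) (c : Plane) (p q : ℝ) :
    rectangle (dirOfAngle t) c p q = rectangle (dirOfAngle (t + Real.pi / 2)) c q p := by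
  ext y
  have h : inner ℝ (y - c) (rotQuarter (dirOfAngle (t + Real.pi / 2)))
      = - inner ℝ (y - c) (dirOfAngle t) := by
    rw [inner_rotQuarter_dirOfAngle, inner_dirOfAngle, Real.cos_add_pi_div_two,
      Real.sin_add_pi_div_two]
    ring
  simp only [rectangle, Set.mem_ofPred_eq]
  rw [h, abs_neg, ← rotQuarter_dirOfAngle, and_comm]

/-- A rectangle whose long side has an angle close to `β` lies in a parallelogram with two sides of
the same direction whose other sides are parallel to the second vector of the frame, and
whose area is a multiple of its own. -/
theorem frame_mem_openSet {β t : ℝ} (ht : |t - β| ≤ 1 / 16) (c : Plane) {p q : ℝ} (hp : 0 < p)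
    (hq : 0 < q) (hqp : q ≤ p) {y : Plane} (hy : y ∈ rectangle (dirOfAngle t) c p q) :
    frame β y ∈ (⟨Real.tan (t - β), frame β c, 3 * p, 3 * q, by positivity, by positivity⟩ :
      Para).openSet := by
  obtain ⟨h1, h2⟩ := hy
  obtain ⟨γ, rfl⟩ : ∃ γ, β = t - γ := ⟨t - β, by ring⟩
  simp only [sub_sub_cancel] at ht ⊢
  have hcos : 1 / 2 ≤ Real.cos γ := by
    have := Real.one_sub_sq_div_two_le_cos (x := γ)
    rw [abs_le] at ht
    nlinarith
  set d := y - c with hd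
  set a := inner ℝ d (dirOfAngle t) with ha
  set b := inner ℝ d (rotQuarter (dirOfAngle t)) with hb
  have e1 : (frame (t - γ) y).1 - (frame (t - γ) c).1 = a * Real.cos γ - b * Real.sin γ := by
    rw [ha, hb]
    simp only [frame]
    rw [← inner_sub_left, ← hd, inner_dirOfAngle, inner_dirOfAngle, inner_rotQuarter_dirOfAngle,
      Real.cos_sub, Real.sin_sub]
    ring
  have e2 : (frame (t - γ) y).2 - (frame (t - γ) c).2 = a * Real.sin γ + b * Real.cos γ := by
    rw [ha, hb]
    simp only [frame]
    rw [← inner_sub_left, ← hd, inner_rotQuarter_dirOfAngle, inner_dirOfAngle,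
      inner_rotQuarter_dirOfAngle, Real.cos_sub, Real.sin_sub]
    ring
  have hac : |a * Real.cos γ| ≤ p := by
    rw [abs_mul]
    exact (mul_le_mul h1 (Real.abs_cos_le_one γ) (abs_nonneg _) hp.le).trans_eq (mul_one p)
  have hbs : |b * Real.sin γ| ≤ q := by
    rw [abs_mul]
    exact (mul_le_mul h2 (Real.abs_sin_le_one γ) (abs_nonneg _) hq.le).trans_eq (mul_one q)
  constructor
  · simp only
    rw [e1]
    have := abs_sub (a * Real.cos γ) (b * Real.sin γ)
    linarith
  · simp only
    rw [← sub_sub, e2, e1, Real.tan_eq_sin_div_cos]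
    have e3 : a * Real.sin γ + b * Real.cos γ
        - Real.sin γ / Real.cos γ * (a * Real.cos γ - b * Real.sin γ) = b / Real.cos γ := by
      have h0 : Real.cos γ ≠ 0 := by linarith
      field_simp
      linear_combination b * Real.sin_sq_add_cos_sq γ
    rw [e3, abs_div, abs_of_pos (by linarith : 0 < Real.cos γ), div_lt_iff₀ (by linarith)]
    nlinarith

/-- The average of `h` over a rectangle is controlled by the maximal operator in a frame adapted to
the long side. -/
theorem rectangle_average_le {β t : ℝ} (ht : |t - β| ≤ 1 / 16) (c : Plane) {p q : ℝ} (hp : 0 < p)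
    (hq : 0 < q) (hqp : q ≤ p) {T : Set ℝ} (hT : Real.tan (t - β) ∈ T) {h : Plane → ℝ≥0∞}
    (hh : Measurable h) {e : Plane ≃ᵐ ℝ × ℝ} (he : MeasurePreserving e volume volume)
    (hef : ∀ y, e y = frame β y) {x : Plane} (hx : x ∈ rectangle (dirOfAngle t) c p q) :
    (volume (rectangle (dirOfAngle t) c p q))⁻¹ * ∫⁻ y in rectangle (dirOfAngle t) c p q, h y
      ≤ 9 * paraMax T (fun z => h (e.symm z)) (e x) := by
  let P : Para := ⟨Real.tan (t - β), frame β c, 3 * p, 3 * q, by positivity, by positivity⟩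
  have harea : P.area = 9 * volume (rectangle (dirOfAngle t) c p q) := by
    rw [volume_rectangle t c hp hq, Para.area, show (9 : ℝ≥0∞) = ENNReal.ofReal 9 by norm_num,
      ← ENNReal.ofReal_mul (by positivity), ← ENNReal.ofReal_mul (by positivity)]
    congr 1
    simp only [P]
    ring
  have hint : ∫⁻ y in rectangle (dirOfAngle t) c p q, h y
      ≤ ∫⁻ z in P.toSet, h (e.symm z) := by
    rw [← he.setLIntegral_comp_preimage P.measurableSet_toSet (f := fun z => h (e.symm z))
      (hh.comp e.symm.measurable)]
    simp only [MeasurableEquiv.symm_apply_apply]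
    refine lintegral_mono_set fun y hy => ?_
    rw [Set.mem_preimage, hef]
    exact P.openSet_subset (frame_mem_openSet ht c hp hq hqp hy)
  have hmax : P.average (fun z => h (e.symm z)) ≤ paraMax T (fun z => h (e.symm z)) (e x) := by
    refine le_trans (le_of_eq ?_) (le_iSup (fun P : {P : Para // P.slope ∈ T} =>
      P.1.openSet.indicator (fun _ => P.1.average fun z => h (e.symm z)) (e x)) ⟨P, hT⟩)
    rw [Set.indicator_of_mem]
    rw [hef]
    exact frame_mem_openSet ht c hp hq hqp hx
  refine le_trans ?_ (mul_le_mul_right hmax 9)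
  rw [Para.average, harea, div_eq_mul_inv, ENNReal.mul_inv (Or.inl (by norm_num))
    (Or.inl (by norm_num)), mul_left_comm, ← mul_assoc 9, ENNReal.mul_inv_cancel (by norm_num)
    (by norm_num), one_mul, mul_comm]
  exact mul_le_mul_left hint _

/-! ### The directional maximal operator -/

theorem le_directionalMaximal {Ω : Set Plane} {f : Plane → ℂ} {R : Set Plane}
    (hR : R ∈ rectanglesOf Ω) {x : Plane} (hx : x ∈ R) :
    (volume R)⁻¹ * ∫⁻ y in R, ‖f y‖ₑ ≤ directionalMaximal Ω f x :=
  le_iSup_of_le R (le_iSup_of_le hR (le_iSup_of_le hx le_rfl))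

/-- Every rectangle lies in the interior of a slightly larger one with almost the same average. -/
theorem lowerSemicontinuous_directionalMaximal {Ω : Set Plane} (hΩ : ∀ u ∈ Ω, ‖u‖ = 1)
    (f : Plane → ℂ) : LowerSemicontinuous (directionalMaximal Ω f) := by
  intro x a ha
  simp only [directionalMaximal, lt_iSup_iff] at ha
  obtain ⟨_, ⟨u, hu, c, p, q, hp, hq, rfl⟩, hx, ha⟩ := ha
  obtain ⟨t, -, -, rfl⟩ := exists_dirOfAngle_eq (hΩ u hu) 0
  set J := ∫⁻ y in rectangle (dirOfAngle t) c p q, ‖f y‖ₑ with hJ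
  have hcont : Filter.Tendsto (fun ε : ℝ => a * ENNReal.ofReal ((1 + ε) ^ 2))
      (nhdsWithin 0 (Set.Ioi 0)) (nhds (a * ENNReal.ofReal ((1 + 0) ^ 2))) := by
    refine ENNReal.Tendsto.const_mul ?_ (Or.inr ha.ne_top)
    refine (ENNReal.continuous_ofReal.comp (by fun_prop)).continuousAt.tendsto.mono_left
      nhdsWithin_le_nhds
  have hev := hcont.eventually_lt_const (u := (volume (rectangle (dirOfAngle t) c p q))⁻¹ * J)
    (by simpa using ha)
  obtain ⟨ε, hε, hε0⟩ := (hev.and self_mem_nhdsWithin).exists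
  replace hε0 : 0 < ε := hε0
  have hp' : 0 < p * (1 + ε) := by positivity
  have hq' : 0 < q * (1 + ε) := by positivity
  have hlt : a < (volume (rectangle (dirOfAngle t) c (p * (1 + ε)) (q * (1 + ε))))⁻¹ *
      ∫⁻ y in rectangle (dirOfAngle t) c (p * (1 + ε)) (q * (1 + ε)), ‖f y‖ₑ := by
    have hsub : rectangle (dirOfAngle t) c p q
        ⊆ rectangle (dirOfAngle t) c (p * (1 + ε)) (q * (1 + ε)) := fun y hy =>
      ⟨hy.1.trans (by nlinarith), hy.2.trans (by nlinarith)⟩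
    refine lt_of_lt_of_le ?_ (mul_le_mul_right (lintegral_mono_set hsub) _)
    rw [volume_rectangle t c hp' hq', show 4 * (p * (1 + ε)) * (q * (1 + ε))
      = (1 + ε) ^ 2 * (4 * p * q) by ring, ENNReal.ofReal_mul (by positivity),
      ← volume_rectangle t c hp hq, ENNReal.mul_inv (Or.inr (by
        rw [volume_rectangle t c hp hq]; exact ENNReal.ofReal_ne_top))
        (Or.inl ENNReal.ofReal_ne_top), mul_assoc, mul_comm, ← div_eq_mul_inv,
      ENNReal.lt_div_iff_mul_lt (Or.inl (by
        rw [ne_eq, ENNReal.ofReal_eq_zero, not_le]; positivity)) (Or.inl ENNReal.ofReal_ne_top)]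
    exact hε
  have hopen : IsOpen {y : Plane | |inner ℝ (y - c) (dirOfAngle t)| < p * (1 + ε) ∧
      |inner ℝ (y - c) (rotQuarter (dirOfAngle t))| < q * (1 + ε)} := by
    have h1 : IsOpen {y : Plane | |inner ℝ (y - c) (dirOfAngle t)| < p * (1 + ε)} :=
      isOpen_lt (by fun_prop) (by fun_prop)
    have h2 : IsOpen {y : Plane | |inner ℝ (y - c) (rotQuarter (dirOfAngle t))| < q * (1 + ε)} :=
      isOpen_lt (by fun_prop) (by fun_prop)
    exact h1.inter h2
  filter_upwards [hopen.mem_nhds (x := x)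
    ⟨hx.1.trans_lt (by nlinarith), hx.2.trans_lt (by nlinarith)⟩] with y hy
  exact hlt.trans_le (le_directionalMaximal ⟨_, hu, c, _, _, hp', hq', rfl⟩ ⟨hy.1.le, hy.2.le⟩)

/-- The `L²` bound for the directional maximal operator, from the bound in the small windows: the
circle is covered by `101` windows, and in each of them the long side of a rectangle is either the
side along the direction or the side orthogonal to it. -/
theorem AngularBound.lintegral_sq_directionalMaximal_le {Ω : Set Plane} (hΩ : ∀ u ∈ Ω, ‖u‖ = 1)
    {B : ℝ≥0} (h : AngularBound Ω B) {f : Plane → ℂ} (hf : MemLp f 2 volume) :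
    ∫⁻ x, directionalMaximal Ω f x ^ 2
      ≤ ((2000 * B : ℝ≥0) : ℝ≥0∞) ^ 2 * ∫⁻ x, ‖f x‖ₑ ^ 2 := by
  obtain ⟨φ, hφm, hφ⟩ := hf.aestronglyMeasurable.enorm
  have hG : ∫⁻ x, ‖f x‖ₑ ^ 2 = ∫⁻ x, φ x ^ 2 :=
    lintegral_congr_ae (hφ.mono fun x (hx : ‖f x‖ₑ = φ x) => by simp only [hx])
  have hGt : ∫⁻ x, φ x ^ 2 ≠ ⊤ := by
    rw [← hG]
    have := lintegral_rpow_enorm_lt_top_of_eLpNorm_lt_top (p := 2) (by norm_num) (by norm_num)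
      hf.eLpNorm_lt_top
    simpa using this.ne
  obtain ⟨I, hI, hcard⟩ : ∃ I : Finset (ℕ × ℕ),
      (∀ m j, m < 101 → j < 2 → (m, j) ∈ I) ∧ I.card = 202 :=
    ⟨Finset.range 101 ×ˢ Finset.range 2, fun m j hm hj => by simp [hm, hj], by simp⟩
  let α : ℕ × ℕ → ℝ := fun i => i.1 / 16
  let β : ℕ × ℕ → ℝ := fun i => i.1 / 16 + i.2 * (Real.pi / 2)
  choose e he hef using fun i => exists_measurableEquiv_frame (β i)
  let U : ℕ × ℕ → Plane → ℝ≥0∞ := fun i x =>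
    paraMax (slopes (α i) Ω) (fun z => φ ((e i).symm z)) (e i x)
  have hUm : ∀ i, Measurable (U i) := fun i => (measurable_paraMax _ _).comp (e i).measurable
  have hU : ∀ i, ∫⁻ x, U i x ^ 2 ≤ (B : ℝ≥0∞) ^ 2 * ∫⁻ x, φ x ^ 2 := by
    intro i
    have e1 : ∫⁻ x, φ x ^ 2 = ∫⁻ z, φ ((e i).symm z) ^ 2 := by
      rw [← (he i).lintegral_comp (f := fun z => φ ((e i).symm z) ^ 2)
        ((hφm.comp (e i).symm.measurable).pow_const 2)]
      simp
    rw [(he i).lintegral_comp ((measurable_paraMax _ _).pow_const 2), e1]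
    exact (h (α i)).lintegral_sq_paraMax_le (hφm.comp (e i).symm.measurable) (by rwa [← e1])
  have hle : ∀ x, directionalMaximal Ω f x ≤ 9 * ∑ i ∈ I, U i x := by
    intro x
    refine iSup_le fun R => iSup_le fun hR => iSup_le fun hx => ?_
    obtain ⟨u, hu, c, p, q, hp, hq, rfl⟩ := hR
    obtain ⟨t, ht0, ht1, rfl⟩ := exists_dirOfAngle_eq (hΩ u hu) 0
    rw [lintegral_congr_ae (ae_restrict_of_ae hφ)]
    have hm := Nat.floor_le (a := 16 * t) (by linarith)
    have hm' := Nat.lt_floor_add_one (16 * t)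
    set m := ⌊16 * t⌋₊ with hmdef
    have hm101 : m < 101 := by
      have hpi := Real.pi_lt_d4
      have : (m : ℝ) < 101 := by linarith
      exact_mod_cast this
    have hwin : |t - m / 16| ≤ 1 / 16 := by
      rw [abs_le]; constructor <;> linarith
    have hslope : ∀ j : ℕ, Real.tan (t - m / 16) ∈ slopes (α (m, j)) Ω := fun j =>
      ⟨t, hwin, hu, rfl⟩
    have hsingle : ∀ j < 2, U (m, j) x ≤ ∑ i ∈ I, U i x := fun j hj =>
      Finset.single_le_sum (f := fun i => U i x) (fun _ _ => zero_le)
        (hI m j hm101 hj)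
    rcases le_total q p with hqp | hqp
    · have e1 : t - β (m, 0) = t - m / 16 := by simp [β]
      refine (rectangle_average_le (β := β (m, 0)) (T := slopes (α (m, 0)) Ω) (by rwa [e1]) c hp hq
        hqp (by rw [e1]; exact hslope 0) hφm (he _) (hef _) hx).trans ?_
      exact mul_le_mul_right (hsingle 0 (by norm_num)) 9
    · rw [rectangle_add_pi_div_two] at hx ⊢
      have e1 : t + Real.pi / 2 - β (m, 1) = t - m / 16 := by simp [β]
      refine (rectangle_average_le (β := β (m, 1)) (T := slopes (α (m, 1)) Ω) (by rwa [e1]) c hq hp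
        hqp (by rw [e1]; exact hslope 1) hφm (he _) (hef _) hx).trans ?_
      exact mul_le_mul_right (hsingle 1 (by norm_num)) 9
  calc ∫⁻ x, directionalMaximal Ω f x ^ 2
      ≤ ∫⁻ x, 81 * (202 * ∑ i ∈ I, U i x ^ 2) := by
        refine lintegral_mono fun x => ?_
        calc directionalMaximal Ω f x ^ 2 ≤ (9 * ∑ i ∈ I, U i x) ^ 2 := by gcongr; exact hle x
          _ = 81 * (∑ i ∈ I, U i x) ^ 2 := by rw [mul_pow]; norm_num
          _ ≤ _ := by
            refine mul_le_mul_right ((ENNReal.sq_sum_le_card_mul I _).trans_eq ?_) 81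
            rw [hcard]
            norm_num
    _ = 81 * (202 * ∑ i ∈ I, ∫⁻ x, U i x ^ 2) := by
        rw [lintegral_const_mul' _ _ (by norm_num), lintegral_const_mul' _ _ (by norm_num),
          lintegral_finsetSum _ fun i _ => (hUm i).pow_const 2]
    _ ≤ 81 * (202 * ∑ i ∈ I, (B : ℝ≥0∞) ^ 2 * ∫⁻ x, φ x ^ 2) := by
        gcongr with i
        exact hU i
    _ = (3305124 : ℝ≥0∞) * ((B : ℝ≥0∞) ^ 2 * ∫⁻ x, φ x ^ 2) := by
        rw [Finset.sum_const, hcard, nsmul_eq_mul, ← mul_assoc, ← mul_assoc]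
        norm_num
    _ ≤ (2000 : ℝ≥0∞) ^ 2 * ((B : ℝ≥0∞) ^ 2 * ∫⁻ x, φ x ^ 2) := by
        gcongr
        norm_num
    _ = _ := by
        rw [hG, ENNReal.coe_mul, mul_pow, mul_assoc]
        rfl

theorem theorem1 :
    ∃ C : ℝ≥0, ∀ (N : ℕ) (Ω : Set Plane), IsLacunary N Ω →
      ∀ f : Plane → ℂ, MemLp f 2 volume →
        MemLp (directionalMaximal Ω f) 2 volume ∧
        eLpNorm (directionalMaximal Ω f) 2 volume ≤ (C : ℝ≥0∞) * (N : ℝ≥0∞) * eLpNorm f 2 volume := by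
  refine ⟨2000 * (36 + levelConst), fun N Ω hN f hf => ?_⟩
  have hΩ := hN.norm_eq_one
  have hN1 : (1 : ℝ≥0) ≤ N := by exact_mod_cast hN.one_le
  have hB : AngularBound Ω ((36 + levelConst) * N) :=
    hN.angularBound.mono subset_rfl (by
      rw [add_mul, mul_comm levelConst]
      gcongr
      exact le_mul_of_one_le_right zero_le hN1)
  have hsq := hB.lintegral_sq_directionalMaximal_le hΩ hf
  have hnorm : ∀ {F : Type} [ENorm F] (g : Plane → F),
      eLpNorm g 2 volume = (∫⁻ x, ‖g x‖ₑ ^ 2) ^ (1 / 2 : ℝ) := by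
    intro F _ g
    rw [eLpNorm_eq_lintegral_rpow_enorm_toReal (by norm_num) (by norm_num)]
    simp
  have hmain : eLpNorm (directionalMaximal Ω f) 2 volume
      ≤ ((2000 * (36 + levelConst) : ℝ≥0) : ℝ≥0∞) * (N : ℝ≥0∞) * eLpNorm f 2 volume := by
    rw [hnorm, hnorm]
    simp only [enorm_eq_self]
    refine (ENNReal.rpow_le_rpow hsq (by norm_num)).trans (le_of_eq ?_)
    rw [ENNReal.mul_rpow_of_nonneg _ _ (by norm_num), ← ENNReal.rpow_natCast_mul]
    norm_num
    ring
  refine ⟨⟨(lowerSemicontinuous_directionalMaximal hΩ f).measurable.aestronglyMeasurable, ?_⟩, hmain⟩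
  refine hmain.trans_lt (ENNReal.mul_lt_top (ENNReal.mul_lt_top ENNReal.coe_lt_top ?_)
    hf.eLpNorm_lt_top)
  exact ENNReal.natCast_lt_top N
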